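/- Let $0<\varepsilon<\delta$ and let $U=(U(t))_{t\ge 0}$ be a centered Gaussian process with almost surely continuous paths and covariance $$R(s,t)=\begin{cases}\ln\frac{\delta}{\varepsilon}-\left(\frac1\varepsilon-\frac1\delta\right)|t-s|,&|t-s|\le\varepsilon,\\ \ln\frac{\delta}{|t-s|}+\frac{|t-s|}{\delta}-1,&\varepsilon\le|t-s|<\delta,\\ 0,&|t-s|\ge\delta.\end{cases}$$ Let $\gamma\in\mathbb R$ and let $\kappa\in\mathbb R$ be a normalizing constant (for instance $\kappa=\frac{\gamma^2}{2}\ln\frac1\varepsilon$, or $\kappa=\frac{\gamma^2}{2}\mathbb E[U(0)^2]=\frac{\gamma^2}{2}\ln\frac\delta\varepsilon$). Put $d\eta(s)=e^{\gamma U(s)-\kappa}ds$, $\eta(x)=\int_0^x d\eta(s)$, $\eta(x,y)=\eta(y)-\eta(x)$ and $\tau_a=\inf\{t\ge0:\eta(t)\ge a\}$ (with $\inf\emptyset=\infty$). Let $\mathcal H$ be the Hilbert space obtained as the closure of the step functions on $[0,\infty)$ for the scalar product $\langle 1_{[0,s]},1_{[0,t]}\rangle_{\mathcal H}=R(s,t)$,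 and let $h\mapsto U(h)$ be the linear isometry from $\mathcal H$ into $L^2(\Omega)$ with $U(1_{[0,t]})=U(t)$. Let $\mathbb D^{1,2}$ and $D$ be the associated Malliavin-Sobolev space and Malliavin derivative, that is, the closure in $L^2(\Omega)\times L^2(\Omega;\mathcal H)$ of the operator $f(U(h_1),\dots,U(h_n))\mapsto\sum_{i}\partial_i f(U(h_1),\dots,U(h_n))\,h_i$ with $n\ge 1$, $f\in C_b^\infty(\mathbb R^n)$ and $h_i\in\mathcal H$. An element of $\mathcal H$ is identified with a function on $[0,\infty)$ when it is the limit in $\mathcal H$ of step functions that converge uniformly to that function. Let $\phi\ge0$ be a smooth function with compact support in $(0,\infty)$, let $T>0$, and let $$Y=\int_0^\infty\phi(a)\,(\tau_a\wedge T)\,da .$$ Then $Y\in\mathbb D^{1,2}$ and $$DY=-\gamma\int_0^T\phi(\eta(\theta))\int_0^\theta 1_{[0,s]}\,d\eta(s)\,d\theta$$ (Bochner integrals in $\mathcal H$). Almost surely, $DY$ is the function $r\mapsto D_rY$ on $[0,\infty)$ given by $$D_rY=-\gamma\int_0^T\phi(\eta(\theta))\,\eta(r,\theta\vee r)\,d\theta=-\gamma\int_0^T\phi(\eta(\theta))\int_0^\theta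 1_{[0,s]}(r)\,d\eta(s)\,d\theta ,\qquad r\ge0,$$ and for all $r\in[0,T]$ $$D_rY=-\gamma\int_{\eta(r)}^{\eta(T)}\phi(y)\,(y-\eta(r))\,d\tau_y$$ as a Lebesgue-Stieltjes integral. -/

import Mathlib

open MeasureTheory ProbabilityTheory Filter Topology
open scoped NNReal ENNReal

noncomputable section

namespace GaussMalliavin

/-! ### The Hilbert space of a covariance kernel on `[0, ∞)` -/

/-- A symmetric positive semidefinite kernel on `[0, ∞)`. -/
structure CovKernel where
  /-- the kernel `R(s, t)` -/
  toFun : ℝ≥0 → ℝ≥0 → ℝ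
  symm' : ∀ s t, toFun s t = toFun t s
  nonneg' : ∀ c : ℝ≥0 →₀ ℝ, 0 ≤ c.sum fun s a => c.sum fun t b => a * b * toFun s t

/-- Step functions on `[0, ∞)`: `c` stands for the function `∑ₜ c t • 1_{[0,t]}`, which determines
the coefficients `c`. The kernel only serves to choose the scalar product. -/
def StepFun (_K : CovKernel) : Type := ℝ≥0 →₀ ℝ

variable (K : CovKernel)

instance : AddCommGroup (StepFun K) := inferInstanceAs (AddCommGroup (ℝ≥0 →₀ ℝ))

instance : Module ℝ (StepFun K) := inferInstanceAs (Module ℝ (ℝ≥0 →₀ ℝ))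

/-- The step function `1_{[0,t]}`. -/
def StepFun.ind (t : ℝ≥0) : StepFun K := Finsupp.single t 1

variable {K} in
/-- The step function as an actual function of `r ∈ [0, ∞)`. -/
def StepFun.eval (c : StepFun K) (r : ℝ≥0) : ℝ :=
  Finsupp.sum (show ℝ≥0 →₀ ℝ from c) fun t a => a * (Set.Icc 0 t).indicator 1 r

/-- The bilinear form on step functions with `⟨1_{[0,s]}, 1_{[0,t]}⟩ = R(s, t)`. -/
def CovKernel.form (c d : ℝ≥0 →₀ ℝ) : ℝ := c.sum fun s a => d.sum fun t b => a * b * K.toFun s t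

theorem CovKernel.form_symm (c d : ℝ≥0 →₀ ℝ) : K.form d c = K.form c d := by
  unfold CovKernel.form
  rw [Finsupp.sum_comm]
  refine Finsupp.sum_congr fun s _ => Finsupp.sum_congr fun t _ => ?_
  rw [K.symm', mul_comm (d t)]

theorem CovKernel.form_add (c d e : ℝ≥0 →₀ ℝ) : K.form (c + d) e = K.form c e + K.form d e := by
  refine Finsupp.sum_add_index' (fun s => ?_) (fun s a b => ?_)
  · simp [Finsupp.sum]
  · simp [add_mul, Finsupp.sum, Finset.sum_add_distrib]

theorem CovKernel.form_smul (a : ℝ) (c d : ℝ≥0 →₀ ℝ) : K.form (a • c) d = a * K.form c d := by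
  refine (Finsupp.sum_smul_index (fun s => by simp [Finsupp.sum])).trans ?_
  simp only [CovKernel.form, Finsupp.sum, Finset.mul_sum, mul_assoc]

/-- The scalar product of step functions. -/
@[reducible]
def StepFun.core : PreInnerProductSpace.Core ℝ (StepFun K) where
  inner c d := K.form c d
  conj_inner_symm c d := K.form_symm c d
  re_inner_nonneg c := K.nonneg' c
  add_left c d e := K.form_add c d e
  smul_left c d a := K.form_smul a c d

instance : SeminormedAddCommGroup (StepFun K) :=
  @InnerProductSpace.Core.toSeminormedAddCommGroup ℝ (StepFun K) _ _ _ (StepFun.core K)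

instance : InnerProductSpace ℝ (StepFun K) := InnerProductSpace.ofCore (StepFun.core K)

/-- The Hilbert space `ℋ`: the closure of the step functions for the scalar product
`⟨1_{[0,s]}, 1_{[0,t]}⟩ = R(s, t)` (elements at distance zero being identified). -/
abbrev HilbertH : Type := UniformSpace.Completion (StepFun K)

/-- The element `1_{[0,t]}` of `ℋ`. -/
def HilbertH.ind (t : ℝ≥0) : HilbertH K := ((StepFun.ind K t : StepFun K) : HilbertH K)

variable {K}

/-- The element `h` of `ℋ` is the function `f` on `[0, ∞)`: `h` is the limit in `ℋ` of
step functions that converge uniformly to `f`. -/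
def HilbertH.IsFun (h : HilbertH K) (f : ℝ≥0 → ℝ) : Prop :=
  ∃ c : ℕ → StepFun K, TendstoUniformly (fun n => (c n).eval) f atTop ∧
    Tendsto (fun n => (c n : HilbertH K)) atTop (𝓝 h)

section Malliavin

/-! ### Gaussian processes, the Gaussian space and the Malliavin derivative -/

variable {Ω : Type*} [MeasurableSpace Ω]

/-- `X` is a centered Gaussian process with covariance `K`. -/
structure IsCenteredGaussian (K : CovKernel) (X : ℝ≥0 → Ω → ℝ) (P : Measure Ω) : Prop where
  gaussian : IsGaussianProcess X P
  mean : ∀ t, ∫ ω, X t ω ∂P = 0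
  cov : ∀ s t, ∫ ω, X s ω * X t ω ∂P = K.toFun s t

variable {X : ℝ≥0 → Ω → ℝ} {P : Measure Ω}

theorem IsCenteredGaussian.memLp (hX : IsCenteredGaussian K X P) (t : ℝ≥0) : MemLp (X t) 2 P :=
  (hX.gaussian.hasGaussianLaw_eval t).memLp_two

/-- `∑ₜ c t • 1_{[0,t]} ↦ ∑ₜ c t • X t`, as a linear map into `L²`. -/
def wienerLin (hX : IsCenteredGaussian K X P) : StepFun K →ₗ[ℝ] Lp ℝ 2 P :=
  (Finsupp.linearCombination ℝ fun t => (hX.memLp t).toLp (X t) : (ℝ≥0 →₀ ℝ) →ₗ[ℝ] Lp ℝ 2 P)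

theorem inner_wienerLin (hX : IsCenteredGaussian K X P) (c d : StepFun K) :
    inner ℝ (wienerLin hX c) (wienerLin hX d) = inner ℝ c d := by
  have key : ∀ s t, inner ℝ ((hX.memLp s).toLp (X s)) ((hX.memLp t).toLp (X t)) =
      K.toFun s t := by
    intro s t
    rw [← hX.cov s t, L2.inner_def]
    refine integral_congr_ae ?_
    filter_upwards [(hX.memLp s).coeFn_toLp, (hX.memLp t).coeFn_toLp] with ω h1 h2
    rw [h1, h2]
    simp [mul_comm]
  have main : ∀ c d : ℝ≥0 →₀ ℝ,
      inner ℝ (Finsupp.linearCombination ℝ (fun t => (hX.memLp t).toLp (X t)) c)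
        (Finsupp.linearCombination ℝ (fun t => (hX.memLp t).toLp (X t)) d) = K.form c d := by
    intro c d
    simp only [Finsupp.linearCombination_apply, Finsupp.sum_inner, Finsupp.inner_sum, key,
      CovKernel.form, real_inner_smul_left, real_inner_smul_right]
    rw [Finsupp.sum_comm]
    refine Finsupp.sum_congr fun s _ => Finsupp.sum_congr fun t _ => ?_
    ring
  exact main c d

/-- The isometry `∑ₜ c t • 1_{[0,t]} ↦ ∑ₜ c t • X t` from step functions to `L²`. -/
def wienerStep (hX : IsCenteredGaussian K X P) : StepFun K →ₗᵢ[ℝ] Lp ℝ 2 P where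
  toLinearMap := wienerLin hX
  norm_map' c := by
    rw [← sq_eq_sq₀ (norm_nonneg _) (norm_nonneg _), ← real_inner_self_eq_norm_sq,
      ← real_inner_self_eq_norm_sq, inner_wienerLin]

/-- The isometry `h ↦ X(h)` from `ℋ` to the Gaussian space of `X` in `L²`, the extension of
`1_{[0,t]} ↦ X t` by linearity and continuity. -/
def wiener (hX : IsCenteredGaussian K X P) : HilbertH K →L[ℝ] Lp ℝ 2 P :=
  (wienerStep hX).toContinuousLinearMap.extend (UniformSpace.Completion.toComplL)

/-- `C_b^∞(ℝⁿ)`: smooth functions that are bounded together with all their derivatives. -/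
def IsSmoothBounded {n : ℕ} (f : (Fin n → ℝ) → ℝ) : Prop :=
  ContDiff ℝ (⊤ : ℕ∞) f ∧ ∀ k : ℕ, ∃ C : ℝ, ∀ x, ‖iteratedFDeriv ℝ k f x‖ ≤ C

/-- The pairs `(F, DF)` with `F = f(X(h₁), …, X(hₙ))` a smooth cylindrical random variable and
`DF = ∑ᵢ ∂ᵢf(X(h₁), …, X(hₙ)) hᵢ`. -/
def cylGraph (hX : IsCenteredGaussian K X P) : Set (Lp ℝ 2 P × Lp (HilbertH K) 2 P) :=
  {p | ∃ (n : ℕ) (f : (Fin n → ℝ) → ℝ) (h : Fin n → HilbertH K), 1 ≤ n ∧ IsSmoothBounded f ∧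
    (∀ᵐ ω ∂P, p.1 ω = f fun i => wiener hX (h i) ω) ∧
    ∀ᵐ ω ∂P, p.2 ω =
      ∑ i, fderiv ℝ f (fun j => wiener hX (h j) ω) (Pi.single i 1) • h i}

/-- `F` belongs to `𝔻^{1,2}` and `DF = u`: the pair `(F, u)` lies in the closure, in
`L²(Ω) × L²(Ω; ℋ)`, of the pairs `(F, DF)` with `F` smooth and cylindrical. -/
def HasMalliavinDeriv (hX : IsCenteredGaussian K X P) (F : Ω → ℝ) (u : Ω → HilbertH K) : Prop :=
  ∃ (hF : MemLp F 2 P) (hu : MemLp u 2 P), (hF.toLp F, hu.toLp u) ∈ closure (cylGraph hX)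

end Malliavin

/-! ### The covariance of the truncated logarithmic field -/

/-- The covariance as a function of the distance `d`, with truncations `ε < δ`. -/
def logCov (ε δ d : ℝ) : ℝ :=
  if d ≤ ε then Real.log (δ / ε) - (1 / ε - 1 / δ) * d
  else if d < δ then Real.log (δ / d) + d / δ - 1
  else 0

theorem integral_aux {a b : ℝ} (ha : 0 < a) (hab : a ≤ b) (d : ℝ) :
    ∫ y in a..b, (y - d) / y ^ 2 = Real.log (b / a) - (1 / a - 1 / b) * d := by
  have hb : 0 < b := ha.trans_le hab
  have hpos : ∀ y ∈ Set.uIcc a b, 0 < y := fun y hy => by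
    rw [Set.uIcc_of_le hab] at hy
    exact ha.trans_le hy.1
  rw [intervalIntegral.integral_eq_sub_of_hasDerivAt (f := fun y => Real.log y + d * y⁻¹)]
  · rw [Real.log_div hb.ne' ha.ne']
    field_simp
    ring
  · intro y hy
    have hy0 := (hpos y hy).ne'
    refine ((Real.hasDerivAt_log hy0).add ((hasDerivAt_inv hy0).const_mul d)).congr_deriv ?_
    field_simp
    ring
  · refine ContinuousOn.intervalIntegrable fun y hy => ContinuousAt.continuousWithinAt ?_
    have hy0 : y ^ 2 ≠ 0 := pow_ne_zero 2 (hpos y hy).ne'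
    fun_prop (disch := assumption)

theorem intervalIntegrable_aux {a b : ℝ} (ha : 0 < a) (hab : a ≤ b) (d : ℝ) :
    IntervalIntegrable (fun y => max (y - d) 0 / y ^ 2) volume a b := by
  refine ContinuousOn.intervalIntegrable fun y hy => ContinuousAt.continuousWithinAt ?_
  rw [Set.uIcc_of_le hab] at hy
  have hy0 : y ^ 2 ≠ 0 := pow_ne_zero 2 (ha.trans_le hy.1).ne'
  fun_prop (disch := assumption)

theorem integral_aux_pos {a b d : ℝ} (ha : 0 < a) (hab : a ≤ b) (hd : d ≤ a) :
    ∫ y in a..b, max (y - d) 0 / y ^ 2 = Real.log (b / a) - (1 / a - 1 / b) * d := by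
  rw [← integral_aux ha hab d]
  refine intervalIntegral.integral_congr fun y hy => ?_
  rw [Set.uIcc_of_le hab] at hy
  rw [max_eq_left (by linarith [hy.1])]

theorem integral_aux_zero {a b d : ℝ} (hab : a ≤ b) (hd : b ≤ d) :
    ∫ y in a..b, max (y - d) 0 / y ^ 2 = 0 := by
  rw [intervalIntegral.integral_congr (g := fun _ => 0), intervalIntegral.integral_zero]
  intro y hy
  rw [Set.uIcc_of_le hab] at hy
  change max (y - d) 0 / y ^ 2 = 0
  rw [max_eq_right (by linarith [hy.2]), zero_div]

theorem logCov_eq_integral {ε δ d : ℝ} (hε : 0 < ε) (hδ : ε < δ) :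
    logCov ε δ d = ∫ y in ε..δ, max (y - d) 0 / y ^ 2 := by
  unfold logCov
  split_ifs with h1 h2
  · exact (integral_aux_pos hε hδ.le h1).symm
  · push Not at h1
    have hd : 0 < d := hε.trans h1
    rw [← intervalIntegral.integral_add_adjacent_intervals
      (intervalIntegrable_aux hε h1.le d) (intervalIntegrable_aux hd h2.le d),
      integral_aux_zero h1.le le_rfl, integral_aux_pos hd h2.le le_rfl]
    field_simp
    ring
  · push Not at h1 h2
    exact (integral_aux_zero hδ.le h2).symm

theorem tent_eq_integral {y s t : ℝ} (_hy : 0 < y) :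
    max (y - |t - s|) 0 = ∫ u, (Set.Icc s (s + y)).indicator (1 : ℝ → ℝ) u *
      (Set.Icc t (t + y)).indicator 1 u := by
  have : (fun u => (Set.Icc s (s + y)).indicator (1 : ℝ → ℝ) u *
      (Set.Icc t (t + y)).indicator 1 u) =
      (Set.Icc (max s t) (min (s + y) (t + y))).indicator 1 := by
    rw [← Set.Icc_inter_Icc, Set.inter_indicator_one]
    rfl
  rw [this, integral_indicator_one measurableSet_Icc, Measure.real, Real.volume_Icc,
    ENNReal.toReal_ofReal']
  congr 1
  rcases le_total s t with h | h
  · rw [max_eq_right h, min_eq_left (by linarith), abs_of_nonneg (by linarith)]; ring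
  · rw [max_eq_left h, min_eq_right (by linarith), abs_of_nonpos (by linarith)]; ring

theorem tent_posSemidef {y : ℝ} (hy : 0 < y) (c : ℝ≥0 →₀ ℝ) :
    0 ≤ ∑ s ∈ c.support, ∑ t ∈ c.support, c s * c t * max (y - |(t : ℝ) - s|) 0 := by
  have hint : ∀ s t : ℝ≥0, Integrable fun u : ℝ =>
      c s * c t * ((Set.Icc (s : ℝ) (s + y)).indicator (1 : ℝ → ℝ) u *
        (Set.Icc (t : ℝ) (t + y)).indicator 1 u) := by
    intro s t
    refine Integrable.const_mul ?_ _
    have : (fun u => (Set.Icc (s : ℝ) (s + y)).indicator (1 : ℝ → ℝ) u *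
      (Set.Icc (t : ℝ) (t + y)).indicator 1 u) =
      (Set.Icc (s : ℝ) (s + y) ∩ Set.Icc (t : ℝ) (t + y)).indicator 1 := by
      rw [Set.inter_indicator_one]
      rfl
    rw [this, integrable_indicator_iff (measurableSet_Icc.inter measurableSet_Icc)]
    refine integrableOn_const (by
      refine ne_top_of_le_ne_top ?_ (measure_mono Set.inter_subset_left)
      simp)
  have : ∑ s ∈ c.support, ∑ t ∈ c.support, c s * c t * max (y - |(t : ℝ) - s|) 0 =
      ∫ u : ℝ, (∑ s ∈ c.support, c s * (Set.Icc (s : ℝ) (s + y)).indicator (1 : ℝ → ℝ) u) ^ 2 := by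
    simp_rw [tent_eq_integral hy, ← integral_const_mul, sq, Finset.sum_mul_sum]
    rw [integral_finsetSum _ fun s _ => ?_]
    · refine Finset.sum_congr rfl fun s _ => ?_
      rw [integral_finsetSum _ fun t _ => ?_]
      · refine Finset.sum_congr rfl fun t _ => integral_congr_ae (ae_of_all _ fun u => ?_)
        simp only
        ring
      · refine (hint s t).congr (ae_of_all _ fun u => ?_)
        simp only
        ring
    · refine integrable_finsetSum _ fun t _ => (hint s t).congr (ae_of_all _ fun u => ?_)
      simp only
      ring
  rw [this]
  exact integral_nonneg fun u => sq_nonneg _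

theorem logCov_posSemidef {ε δ : ℝ} (hε : 0 < ε) (hδ : ε < δ) (c : ℝ≥0 →₀ ℝ) :
    0 ≤ c.sum fun s a => c.sum fun t b => a * b * logCov ε δ |(t : ℝ) - s| := by
  have : (c.sum fun s a => c.sum fun t b => a * b * logCov ε δ |(t : ℝ) - s|) =
      ∫ y in ε..δ, (∑ s ∈ c.support, ∑ t ∈ c.support,
        c s * c t * max (y - |(t : ℝ) - s|) 0) / y ^ 2 := by
    simp_rw [Finset.sum_div, mul_div_assoc]
    have hi : ∀ s t : ℝ≥0, IntervalIntegrable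
        (fun y => c s * c t * (max (y - |(t : ℝ) - s|) 0 / y ^ 2)) volume ε δ :=
      fun s t => (intervalIntegrable_aux hε hδ.le _).const_mul _
    rw [intervalIntegral.integral_finsetSum fun s _ => ?_]
    · refine Finset.sum_congr rfl fun s _ => ?_
      rw [intervalIntegral.integral_finsetSum fun t _ => hi s t]
      refine Finset.sum_congr rfl fun t _ => ?_
      rw [intervalIntegral.integral_const_mul, ← logCov_eq_integral hε hδ]
    · simpa only [Finset.sum_fn] using IntervalIntegrable.sum _ fun t _ => hi s t
  rw [this]
  refine intervalIntegral.integral_nonneg hδ.le fun y hy => ?_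
  exact div_nonneg (tent_posSemidef (hε.trans_le hy.1) c) (sq_nonneg y)

/-- The covariance kernel `R(s, t)` of the field with truncations `0 < ε < δ`. -/
def logKernel {ε δ : ℝ} (hε : 0 < ε) (hδ : ε < δ) : CovKernel where
  toFun s t := logCov ε δ |(t : ℝ) - s|
  symm' s t := by rw [abs_sub_comm]
  nonneg' := logCov_posSemidef hε hδ

/-! ### The chaos, its inverse and the mollified truncated inverse -/

variable {Ω : Type*}

/-- The density `exp(γ U(s) - κ)` of the chaos, with normalizing constant `κ`. -/
def chaosDensity (γ κ : ℝ) (U : ℝ≥0 → Ω → ℝ) (s : ℝ) (ω : Ω) : ℝ :=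
  Real.exp (γ * U s.toNNReal ω - κ)

/-- `η(x) = ∫₀ˣ exp(γ U(s) - κ) ds`. -/
def chaos (γ κ : ℝ) (U : ℝ≥0 → Ω → ℝ) (x : ℝ) (ω : Ω) : ℝ :=
  ∫ s in (0 : ℝ)..x, chaosDensity γ κ U s ω

/-- The inverse `τ_a = inf {t ≥ 0 : η(t) ≥ a}`, with `inf ∅ = ∞`. -/
def chaosInv (γ κ : ℝ) (U : ℝ≥0 → Ω → ℝ) (a : ℝ) (ω : Ω) : ℝ≥0∞ :=
  ⨅ (t : ℝ≥0) (_ : a ≤ chaos γ κ U t ω), (t : ℝ≥0∞)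

/-- The truncated inverse `τ_a ∧ T`. -/
def truncInv (γ κ : ℝ) (U : ℝ≥0 → Ω → ℝ) (T a : ℝ) (ω : Ω) : ℝ :=
  (min (chaosInv γ κ U a ω) (ENNReal.ofReal T)).toReal

theorem truncInv_mono (γ κ : ℝ) (U : ℝ≥0 → Ω → ℝ) (T : ℝ) (ω : Ω) :
    Monotone fun a => truncInv γ κ U T a ω := by
  intro a b hab
  refine ENNReal.toReal_mono (ne_top_of_le_ne_top ENNReal.ofReal_ne_top (min_le_right _ _)) ?_
  refine min_le_min_right _ ?_
  refine le_iInf₂ fun t ht => iInf₂_le t (hab.trans ht)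

/-- The Lebesgue-Stieltjes measure `d(τ_y ∧ T)`. It is `dτ_y` on `[0, η(T)]`, because there
`τ_y ≤ T`. -/
def invMeasure (γ κ : ℝ) (U : ℝ≥0 → Ω → ℝ) (T : ℝ) (ω : Ω) : Measure ℝ :=
  (truncInv_mono γ κ U T ω).stieltjesFunction.measure

/-- `Y = ∫₀^∞ φ(a) (τ_a ∧ T) da`. -/
def mollInv (γ κ : ℝ) (U : ℝ≥0 → Ω → ℝ) (φ : ℝ → ℝ) (T : ℝ) (ω : Ω) : ℝ :=
  ∫ a in Set.Ioi (0 : ℝ), φ a * truncInv γ κ U T a ω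

end GaussMalliavin

end

open GaussMalliavin

namespace GaussMalliavin

noncomputable section

/-! Strict monotonicity of `η` gives `θ < τ_a ∧ T ↔ η(θ) < a` for `0 ≤ θ < T`. Hence `τ_a ∧ T` is
the integral of `1_{η(θ) < a}` over `θ ∈ (0, T)`, and Fubini yields `Y = ∫₀ᵀ Φ(η(θ)) dθ` with `Φ(x)
= ∫_x^∞ φ` (`mollInv_eq_integral`). Since `Φ' = -φ` and formally `Dη(θ) = γ ∫₀^θ 1_{[0,s]} dη(s)`,
the chain rule predicts the formula for `DY`.

To justify it, both integrals are replaced by Riemann sums of mesh `T/N`, and `exp(γx - κ)` by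
`exp(γ N sin(x/N) - κ)`, which is periodic and hence bounded with all its derivatives. The result
`regFun` is a smooth cylindrical variable with derivative `regDeriv` (`mem_cylGraph_regFun`). One
limit `N → ∞` removes both the mesh and the cut-off (`tendsto_regFun`, `tendsto_regDeriv`).

No exponential moment is needed. The derivative of a Riemann sum `S` of `η` has norm at most a
constant times `S` itself, so it only appears through `|φ(S)| S`, which is bounded because `φ` has
compact support (`norm_regDeriv_le`). The bounds are thus deterministic and uniform in `N`, and
almost sure convergence upgrades to convergence in `L²`.

The approximating derivatives are random step functions. Evaluated at `r` they converge uniformly in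
`r` to the claimed function (`tendstoUniformly_eval_regDeriv`), while they converge to `DY` in `ℋ`;
this is the identification of `DY` with a function. The Stieltjes form is the substitution `y =
η(θ)`, because `dτ` is the image of Lebesgue measure under `η` (`invMeasure_eq_map`). -/

/-! ### Smooth functions with bounded derivatives -/

/-- Smooth functions between normed spaces, bounded together with all their derivatives. -/
def SmoothBounded {E F : Type*} [NormedAddCommGroup E] [NormedSpace ℝ E] [NormedAddCommGroup F]
    [NormedSpace ℝ F] (f : E → F) : Prop :=
  ContDiff ℝ (⊤ : ℕ∞) f ∧ ∀ k : ℕ, ∃ C : ℝ, ∀ x, ‖iteratedFDeriv ℝ k f x‖ ≤ C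

section SmoothBounded

variable {E F : Type*} [NormedAddCommGroup E] [NormedSpace ℝ E] [NormedAddCommGroup F]
  [NormedSpace ℝ F]

theorem SmoothBounded.sum {ι : Type*} {f : ι → E → F} (s : Finset ι)
    (hf : ∀ i ∈ s, SmoothBounded (f i)) : SmoothBounded fun x => ∑ i ∈ s, f i x := by
  refine ⟨ContDiff.sum fun i hi => (hf i hi).1, fun k => ?_⟩
  choose! C hC using fun i hi => (hf i hi).2 k
  refine ⟨∑ i ∈ s, C i, fun x => ?_⟩
  rw [iteratedFDeriv_sum fun i hi => (hf i hi).1.of_le (mod_cast le_top), Finset.sum_apply]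
  exact norm_sum_le_of_le _ fun i hi => hC i hi x

theorem SmoothBounded.const_smul {f : E → F} (hf : SmoothBounded f) (a : ℝ) :
    SmoothBounded (a • f) := by
  refine ⟨contDiff_const.smul hf.1, fun k => ?_⟩
  obtain ⟨C, hC⟩ := hf.2 k
  refine ⟨‖a‖ * C, fun x => ?_⟩
  rw [iteratedFDeriv_const_smul_apply (hf.1.contDiffAt.of_le (mod_cast le_top)), norm_smul]
  exact mul_le_mul_of_nonneg_left (hC x) (norm_nonneg a)

theorem SmoothBounded.comp {g : ℝ → F} {f : E → ℝ} (hg : SmoothBounded g)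
    (hf : SmoothBounded f) : SmoothBounded (g ∘ f) := by
  refine ⟨hg.1.comp hf.1, fun k => ?_⟩
  choose C hC using hg.2
  choose D hD using hf.2
  have hC0 : ∀ i, 0 ≤ C i := fun i => (norm_nonneg _).trans (hC i 0)
  have hD0 : ∀ i, 0 ≤ D i := fun i => (norm_nonneg _).trans (hD i 0)
  -- The bound for compositions wants the `i`-th inner derivative below `D ^ i` for a single `D`.
  -- Adding 1 to the sum makes the base at least 1, so the power dominates.
  refine ⟨k.factorial * (∑ i ∈ Finset.range (k + 1), C i) *
    (1 + ∑ i ∈ Finset.range (k + 1), D i) ^ k, fun x => ?_⟩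
  refine norm_iteratedFDeriv_comp_le hg.1 hf.1 (mod_cast le_top) x (fun i hi => ?_)
    fun i hi1 hi => ?_
  · exact (hC i _).trans (Finset.single_le_sum (fun i _ => hC0 i)
      (Finset.mem_range.2 (Nat.lt_succ_of_le hi)))
  · have h1 : D i ≤ ∑ i ∈ Finset.range (k + 1), D i :=
      Finset.single_le_sum (fun i _ => hD0 i) (Finset.mem_range.2 (Nat.lt_succ_of_le hi))
    have h2 : (1 : ℝ) ≤ 1 + ∑ i ∈ Finset.range (k + 1), D i := by linarith [hD0 i]
    calc _ ≤ D i := hD i x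
      _ ≤ 1 + ∑ i ∈ Finset.range (k + 1), D i := by linarith
      _ ≤ _ := le_self_pow₀ h2 (by omega)

theorem SmoothBounded.comp_clm {g : ℝ → F} (hg : SmoothBounded g) (L : E →L[ℝ] ℝ) :
    SmoothBounded (g ∘ L) := by
  refine ⟨hg.1.comp L.contDiff, fun k => ?_⟩
  obtain ⟨C, hC⟩ := hg.2 k
  refine ⟨C * ∏ _i : Fin k, ‖L‖, fun x => ?_⟩
  rw [L.iteratedFDeriv_comp_right hg.1 x (mod_cast le_top)]
  refine (ContinuousMultilinearMap.norm_compContinuousLinearMap_le _ _).trans ?_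
  exact mul_le_mul_of_nonneg_right (hC _) (Finset.prod_nonneg fun _ _ => norm_nonneg _)

theorem SmoothBounded.of_periodic {f : ℝ → F} (hf : ContDiff ℝ (⊤ : ℕ∞) f) {c : ℝ} (hc : 0 < c)
    (hper : Function.Periodic f c) : SmoothBounded f := by
  refine ⟨hf, fun k => ?_⟩
  have hcont : Continuous (iteratedFDeriv ℝ k f) := hf.continuous_iteratedFDeriv (mod_cast le_top)
  obtain ⟨C, hC⟩ := (isCompact_Icc (a := (0 : ℝ)) (b := c)).exists_bound_of_continuousOn
    hcont.continuousOn
  have hper' : Function.Periodic (iteratedFDeriv ℝ k f) c := fun x => by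
    rw [← iteratedFDeriv_comp_add_right]
    congr 1
    exact funext hper
  refine ⟨C, fun x => ?_⟩
  obtain ⟨y, hy, hxy⟩ := hper'.exists_mem_Ico₀ hc x
  rw [hxy]
  exact hC y ⟨hy.1, hy.2.le⟩

end SmoothBounded

/-- The tail primitive `x ↦ ∫_x^∞ φ`. -/
def tailIntegral (φ : ℝ → ℝ) (x : ℝ) : ℝ := ∫ a in Set.Ioi x, φ a

theorem hasDerivAt_tailIntegral {φ : ℝ → ℝ} (hφ : Continuous φ) (hφi : Integrable φ) (x : ℝ) :
    HasDerivAt (tailIntegral φ) (-φ x) x := by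
  have h : tailIntegral φ = fun x => (∫ a, φ a) - ((∫ a in Set.Iic 0, φ a) + ∫ a in (0 : ℝ)..x, φ a) := by
    funext x
    rw [← intervalIntegral.integral_Iic_sub_Iic hφi.integrableOn hφi.integrableOn,
      add_sub_cancel, ← integral_add_compl measurableSet_Iic hφi (s := Set.Iic x), Set.compl_Iic]
    simp [tailIntegral]
  rw [h]
  exact ((hφ.integral_hasStrictDerivAt 0 x).hasDerivAt.const_add _).const_sub _

/-- The tail integral need not have compact support, so order zero is bounded by the `L¹` norm of
`φ`. All higher orders are derivatives of `-φ`, continuous with compact support. -/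
theorem smoothBounded_tailIntegral {φ : ℝ → ℝ} (hφ : ContDiff ℝ (⊤ : ℕ∞) φ)
    (hφc : HasCompactSupport φ) : SmoothBounded (tailIntegral φ) := by
  have hi : Integrable φ := hφ.continuous.integrable_of_hasCompactSupport hφc
  have hd := hasDerivAt_tailIntegral hφ.continuous hi
  have hderiv : deriv (tailIntegral φ) = -φ := funext fun x => (hd x).deriv
  refine ⟨contDiff_infty_iff_deriv.2 ⟨fun x => (hd x).differentiableAt, hderiv ▸ hφ.neg⟩,
    fun k => ?_⟩
  cases k with
  | zero =>
    refine ⟨∫ a, ‖φ a‖, fun x => ?_⟩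
    rw [norm_iteratedFDeriv_zero]
    exact (norm_integral_le_integral_norm _).trans
      (setIntegral_le_integral hi.norm (ae_of_all _ fun _ => norm_nonneg _))
  | succ k =>
    have hcont : Continuous (iteratedFDeriv ℝ k (-φ)) :=
      hφ.neg.continuous_iteratedFDeriv (mod_cast le_top)
    obtain ⟨C, hC⟩ := hcont.bounded_above_of_compact_support (hφc.neg.iteratedFDeriv k)
    refine ⟨C, fun x => ?_⟩
    rw [norm_iteratedFDeriv_eq_norm_iteratedDeriv, iteratedDeriv_succ', hderiv,
      ← norm_iteratedFDeriv_eq_norm_iteratedDeriv]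
    exact hC x

/-- The exponential `exp(γ x - κ)` with `x` replaced by `R sin (x / R)`. -/
def regExp (γ κ R x : ℝ) : ℝ := Real.exp (γ * (R * Real.sin (x / R)) - κ)

/-- The sine is chosen for this: periodicity reduces every derivative bound to a compact period, and
no bump function is required. -/
theorem smoothBounded_regExp (γ κ : ℝ) {R : ℝ} (hR : 0 < R) : SmoothBounded (regExp γ κ R) := by
  refine SmoothBounded.of_periodic (c := 2 * Real.pi * R) ?_ (by positivity) fun x => ?_
  · unfold regExp
    fun_prop
  · unfold regExp
    rw [add_div, mul_div_cancel_right₀ _ hR.ne', Real.sin_add_two_pi]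

theorem hasDerivAt_regExp (γ κ : ℝ) {R : ℝ} (hR : 0 < R) (x : ℝ) :
    HasDerivAt (regExp γ κ R) (γ * Real.cos (x / R) * regExp γ κ R x) x := by
  have h1 : HasDerivAt (fun x : ℝ => x / R) (1 / R) x := (hasDerivAt_id x).div_const R
  have h := ((((Real.hasDerivAt_sin (x / R)).comp x h1).const_mul R).const_mul γ).sub_const κ
  refine h.exp.congr_deriv ?_
  simp only [regExp, Function.comp]
  field_simp

theorem regExp_pos (γ κ R x : ℝ) : 0 < regExp γ κ R x := Real.exp_pos _

/-- Since `|R sin(x/R)| ≤ |x|`, the bound does not depend on `R`; it dominates the sums along a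
fixed path. -/
theorem regExp_le (γ κ : ℝ) {R x M : ℝ} (hR : 0 < R) (hx : |x| ≤ M) :
    regExp γ κ R x ≤ Real.exp (|γ| * M - κ) := by
  refine Real.exp_le_exp.2 (sub_le_sub_right ?_ _)
  refine (le_abs_self _).trans ?_
  rw [abs_mul]
  refine mul_le_mul_of_nonneg_left ?_ (abs_nonneg _)
  refine le_trans ?_ hx
  rw [abs_mul, abs_of_pos hR]
  calc R * |Real.sin (x / R)| ≤ R * |x / R| := mul_le_mul_of_nonneg_left Real.abs_sin_le_abs hR.le
    _ = |x| := by rw [abs_div, abs_of_pos hR]; field_simp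

theorem tendsto_mul_sin_div {ι : Type*} {l : Filter ι} {R x : ι → ℝ} {x₀ : ℝ}
    (hR : Tendsto R l atTop) (hx : Tendsto x l (𝓝 x₀)) :
    Tendsto (fun i => R i * Real.sin (x i / R i)) l (𝓝 x₀) := by
  have h0 : Tendsto (fun i => x i / R i) l (𝓝 0) := hx.div_atTop hR
  have h1 : Tendsto (fun i => x i * Real.sinc (x i / R i)) l (𝓝 (x₀ * Real.sinc 0)) :=
    hx.mul ((Real.continuous_sinc.tendsto 0).comp h0)
  rw [Real.sinc_zero, mul_one] at h1
  refine h1.congr' ?_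
  filter_upwards [hR.eventually_gt_atTop 0] with i hi
  rcases eq_or_ne (x i) 0 with h | h
  · simp [h]
  · rw [Real.sinc_of_ne_zero (div_ne_zero h hi.ne')]
    field_simp

theorem tendsto_regExp (γ κ : ℝ) {ι : Type*} {l : Filter ι} {R x : ι → ℝ} {x₀ : ℝ}
    (hR : Tendsto R l atTop) (hx : Tendsto x l (𝓝 x₀)) :
    Tendsto (fun i => regExp γ κ (R i) (x i)) l (𝓝 (Real.exp (γ * x₀ - κ))) :=
  (Real.continuous_exp.tendsto _).comp
    (((tendsto_mul_sin_div hR hx).const_mul γ).sub_const κ)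

/-! ### Step functions on a uniform grid -/

/-- The left end point `k h` of the interval `(k h, (k + 1) h]` containing `s > 0`. -/
def gridLeft (h s : ℝ) : ℝ := ((⌈s / h⌉₊ - 1 : ℕ) : ℝ) * h

theorem gridLeft_of_mem {h s : ℝ} (hh : 0 < h) {k : ℕ}
    (hs : s ∈ Set.Ioc (k * h) ((k + 1 : ℕ) * h)) : gridLeft h s = k * h := by
  have : ⌈s / h⌉₊ = k + 1 := by
    rw [Nat.ceil_eq_iff (by omega)]
    refine ⟨?_, ?_⟩
    · rw [lt_div_iff₀ hh]
      simpa using hs.1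
    · rw [div_le_iff₀ hh]
      exact hs.2
  rw [gridLeft, this, Nat.add_sub_cancel]

/-- No sign of `s` is needed: truncated subtraction gives the value 0 for `s ≤ 0`. -/
theorem gridLeft_nonneg {h : ℝ} (hh : 0 < h) (s : ℝ) : 0 ≤ gridLeft h s := by
  unfold gridLeft; positivity

theorem gridLeft_lt {h s : ℝ} (hh : 0 < h) (hs : 0 < s) : gridLeft h s < s := by
  have h1 := Nat.ceil_lt_add_one (div_pos hs hh).le
  have h2 : 1 ≤ ⌈s / h⌉₊ := Nat.one_le_iff_ne_zero.2 (Nat.ceil_pos.2 (div_pos hs hh)).ne'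
  rw [gridLeft, Nat.cast_sub h2, ← lt_div_iff₀ hh]
  push_cast
  linarith

theorem sub_le_gridLeft {h s : ℝ} (hh : 0 < h) (hs : 0 < s) : s - h ≤ gridLeft h s := by
  have h1 := Nat.le_ceil (s / h)
  have h2 : 1 ≤ ⌈s / h⌉₊ := Nat.one_le_iff_ne_zero.2 (Nat.ceil_pos.2 (div_pos hs hh)).ne'
  rw [gridLeft, Nat.cast_sub h2]
  rw [div_le_iff₀ hh] at h1
  push_cast
  linarith

theorem tendsto_gridLeft {ι : Type*} {l : Filter ι} {h : ι → ℝ} (hpos : ∀ i, 0 < h i)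
    (hh : Tendsto h l (𝓝 0)) {s : ℝ} (hs : 0 < s) :
    Tendsto (fun i => gridLeft (h i) s) l (𝓝 s) := by
  refine tendsto_of_tendsto_of_tendsto_of_le_of_le (g := fun i => s - h i) ?_ tendsto_const_nhds
    (fun i => sub_le_gridLeft (hpos i) hs) fun i => (gridLeft_lt (hpos i) hs).le
  simpa using hh.const_sub s

/-- The composition factors through `ℕ`, so `f` may be arbitrary. -/
theorem stronglyMeasurable_comp_gridLeft {E : Type*} [TopologicalSpace E] (f : ℝ → E) (h : ℝ) :
    StronglyMeasurable fun s => f (gridLeft h s) := by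
  have : StronglyMeasurable fun n : ℕ => f (((n - 1 : ℕ) : ℝ) * h) := StronglyMeasurable.of_discrete
  exact this.comp_measurable (Nat.measurable_ceil.comp (measurable_id.div_const h))

theorem integral_comp_gridLeft {E : Type*} [NormedAddCommGroup E] [NormedSpace ℝ E]
    [CompleteSpace E] {h : ℝ} (hh : 0 < h) (f : ℝ → E) (j : ℕ) :
    ∫ s in (0 : ℝ)..(j * h), f (gridLeft h s) = h • ∑ k ∈ Finset.range j, f (k * h) := by
  have hle : ∀ k : ℕ, (k : ℝ) * h ≤ (k + 1 : ℕ) * h := fun k =>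
    mul_le_mul_of_nonneg_right (by simp) hh.le
  have heq : ∀ k : ℕ, Set.EqOn (fun s => f (gridLeft h s)) (fun _ => f (k * h))
      (Set.uIoc (k * h) ((k + 1 : ℕ) * h)) := fun k s hs => by
    rw [Set.uIoc_of_le (hle k)] at hs
    simp only [gridLeft_of_mem hh hs]
  have h0 := intervalIntegral.sum_integral_adjacent_intervals (f := fun s => f (gridLeft h s))
    (μ := volume) (a := fun k : ℕ => (k : ℝ) * h) (n := j) fun k _ =>
      (intervalIntegrable_const (c := f (k * h))).congr (heq k).symm
  simp only [Nat.cast_zero, zero_mul] at h0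
  rw [← h0, Finset.smul_sum]
  refine Finset.sum_congr rfl fun k _ => ?_
  rw [intervalIntegral.integral_congr_ae (ae_of_all _ (heq k)), intervalIntegral.integral_const]
  congr 1
  push_cast
  ring

/-! ### Riemann sums along a path -/

section RiemannSum

variable {E : Type*} [NormedAddCommGroup E] [NormedSpace ℝ E]

/-- Dominated convergence on `[0, θ]`, plus an integral over the short interval from `θ` to `p i` of
size at most `C |p i - θ|`. The moving end point is needed because inner Riemann sums stop at the
grid point left of `θ`. -/
theorem tendsto_integral_zero_of_tendsto {ι : Type*} {l : Filter ι} [l.IsCountablyGenerated]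
    {T C θ : ℝ} {v : ι → ℝ → E} {v₀ : ℝ → E} {p : ι → ℝ} (hθ : θ ∈ Set.Icc 0 T)
    (hp : ∀ i, p i ∈ Set.Icc 0 T) (hpθ : Tendsto p l (𝓝 θ)) (hv : ∀ i, StronglyMeasurable (v i))
    (hvC : ∀ i, ∀ s ∈ Set.Ioc 0 T, ‖v i s‖ ≤ C)
    (hlim : ∀ᵐ s, s ∈ Set.Ioc 0 T → Tendsto (fun i => v i s) l (𝓝 (v₀ s))) :
    Tendsto (fun i => ∫ s in (0 : ℝ)..p i, v i s) l (𝓝 (∫ s in (0 : ℝ)..θ, v₀ s)) := by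
  have hT : 0 ≤ T := hθ.1.trans hθ.2
  have hint : ∀ i, ∀ a ∈ Set.Icc 0 T, IntervalIntegrable (v i) volume 0 a := fun i a ha => by
    rw [intervalIntegrable_iff, Set.uIoc_of_le ha.1]
    refine Measure.integrableOn_of_bounded (M := C) (by simp) (hv i).aestronglyMeasurable ?_
    filter_upwards [ae_restrict_mem measurableSet_Ioc] with s hs
    exact hvC i s ⟨hs.1, hs.2.trans ha.2⟩
  have h1 : Tendsto (fun i => ∫ s in (0 : ℝ)..θ, v i s) l (𝓝 (∫ s in (0 : ℝ)..θ, v₀ s)) := by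
    refine intervalIntegral.tendsto_integral_filter_of_dominated_convergence (fun _ => C)
      (Eventually.of_forall fun i => (hv i).aestronglyMeasurable)
      (Eventually.of_forall fun i => ae_of_all _ fun s hs => ?_) intervalIntegrable_const ?_
    · rw [Set.uIoc_of_le hθ.1] at hs
      exact hvC i s ⟨hs.1, hs.2.trans hθ.2⟩
    · filter_upwards [hlim] with s hs hs'
      rw [Set.uIoc_of_le hθ.1] at hs'
      exact hs ⟨hs'.1, hs'.2.trans hθ.2⟩
  have h2 : Tendsto (fun i => ∫ s in θ..p i, v i s) l (𝓝 0) := by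
    refine squeeze_zero_norm (a := fun i => C * |p i - θ|) (fun i => ?_) ?_
    · refine intervalIntegral.norm_integral_le_of_norm_le_const fun s hs => hvC i s ?_
      exact ⟨(le_min hθ.1 (hp i).1).trans_lt hs.1, hs.2.trans (max_le hθ.2 (hp i).2)⟩
    · simpa using ((hpθ.sub_const θ).abs).const_mul C
  have h3 := h1.add h2
  rw [add_zero] at h3
  refine h3.congr fun i => intervalIntegral.integral_add_adjacent_intervals (hint i θ hθ) ?_
  exact (hint i θ hθ).symm.trans (hint i _ (hp i))

/-- The Riemann sum `h ∑_{k < j} exp(γ x_k - κ)` with the regularized exponential. -/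
def regSum (γ κ h R : ℝ) (x : ℕ → ℝ) (j : ℕ) : ℝ :=
  h * ∑ k ∈ Finset.range j, regExp γ κ R (x k)

/-- The iterated Riemann sum of `∫_0^T Φ(η(θ)) dθ`. -/
def regFun (γ κ h : ℝ) (N : ℕ) (Φ : ℝ → ℝ) (x : ℕ → ℝ) : ℝ :=
  h * ∑ j ∈ Finset.range N, Φ (regSum γ κ h N x j)

/-- The iterated Riemann sum of `∫_0^T φ(η(θ)) ∫_0^θ γ w(s) dη(s) dθ`. -/
def regDeriv {V : Type*} [AddCommGroup V] [Module ℝ V] (γ κ h : ℝ) (N : ℕ) (φ : ℝ → ℝ)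
    (x : ℕ → ℝ) (w : ℕ → V) : V :=
  h • ∑ j ∈ Finset.range N, φ (regSum γ κ h N x j) •
    (h • ∑ k ∈ Finset.range j, (γ * Real.cos (x k / N) * regExp γ κ N (x k)) • w k)

theorem regFun_congr {γ κ h : ℝ} {N : ℕ} {Φ : ℝ → ℝ} {x y : ℕ → ℝ}
    (hxy : ∀ k < N, x k = y k) : regFun γ κ h N Φ x = regFun γ κ h N Φ y := by
  unfold regFun regSum
  congr 1
  refine Finset.sum_congr rfl fun j hj => ?_
  congr 2
  refine Finset.sum_congr rfl fun k hk => ?_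
  rw [hxy k ((Finset.mem_range.1 hk).trans (Finset.mem_range.1 hj))]

theorem regDeriv_congr {V : Type*} [AddCommGroup V] [Module ℝ V] {γ κ h : ℝ} {N : ℕ}
    {φ : ℝ → ℝ} {x y : ℕ → ℝ} {w w' : ℕ → V} (hxy : ∀ k < N, x k = y k)
    (hw : ∀ k < N, w k = w' k) : regDeriv γ κ h N φ x w = regDeriv γ κ h N φ y w' := by
  unfold regDeriv regSum
  congr 1
  refine Finset.sum_congr rfl fun j hj => ?_
  have hlt : ∀ k ∈ Finset.range j, k < N := fun k hk =>
    (Finset.mem_range.1 hk).trans (Finset.mem_range.1 hj)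
  congr 2
  · rw [Finset.sum_congr rfl fun k hk => by rw [hxy k (hlt k hk)]]
  · exact Finset.sum_congr rfl fun k hk => by rw [hxy k (hlt k hk), hw k (hlt k hk)]

/-- Linearity in `w` lets one expression serve as a Fréchet derivative (`w` coordinate projections),
as a step function, as an element of `ℋ`, and as the value of the step function at a point. -/
theorem map_regDeriv {V W : Type*} [AddCommGroup V] [Module ℝ V] [AddCommGroup W] [Module ℝ W]
    (L : V →ₗ[ℝ] W) (γ κ h : ℝ) (N : ℕ) (φ : ℝ → ℝ) (x : ℕ → ℝ) (w : ℕ → V) :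
    L (regDeriv γ κ h N φ x w) = regDeriv γ κ h N φ x fun k => L (w k) := by
  simp only [regDeriv, map_smul, map_sum]

theorem continuous_regDeriv {γ κ h : ℝ} {φ : ℝ → ℝ} (hφ : Continuous φ) (N : ℕ) (w : ℕ → E) :
    Continuous fun x => regDeriv γ κ h N φ x w := by
  unfold regDeriv regSum regExp
  fun_prop

/-- The key estimate. As `|cos| ≤ 1` and the exponential reproduces itself under differentiation,
the inner sum is at most `|γ| B` times `regSum`, and this factor is absorbed by `φ`. The bound
involves neither `x` nor the size of the exponential. -/
theorem norm_regDeriv_le {γ κ h : ℝ} (hh : 0 ≤ h) {N : ℕ} {φ : ℝ → ℝ} {C B : ℝ}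
    (hφ : ∀ x, |φ x * x| ≤ C) (hB : 0 ≤ B) (x : ℕ → ℝ) {w : ℕ → E} (hw : ∀ k, ‖w k‖ ≤ B) :
    ‖regDeriv γ κ h N φ x w‖ ≤ h * (N * (|γ| * B * C)) := by
  have key : ∀ j, ‖φ (regSum γ κ h N x j) • (h • ∑ k ∈ Finset.range j,
      (γ * Real.cos (x k / N) * regExp γ κ N (x k)) • w k)‖ ≤ |γ| * B * C := by
    intro j
    have hS : 0 ≤ regSum γ κ h N x j :=
      mul_nonneg hh (Finset.sum_nonneg fun k _ => (regExp_pos _ _ _ _).le)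
    have h1 : ‖h • ∑ k ∈ Finset.range j,
        (γ * Real.cos (x k / N) * regExp γ κ N (x k)) • w k‖ ≤
        |γ| * B * regSum γ κ h N x j := by
      rw [norm_smul, Real.norm_of_nonneg hh, regSum, mul_left_comm]
      refine mul_le_mul_of_nonneg_left ?_ hh
      rw [Finset.mul_sum]
      refine norm_sum_le_of_le _ fun k _ => ?_
      rw [norm_smul, Real.norm_eq_abs, abs_mul, abs_mul, abs_of_pos (regExp_pos _ _ _ _)]
      have hp := (regExp_pos γ κ N (x k)).le
      calc |γ| * |Real.cos (x k / N)| * regExp γ κ N (x k) * ‖w k‖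
          ≤ |γ| * 1 * regExp γ κ N (x k) * B := by
            gcongr
            · exact Real.abs_cos_le_one _
            · exact hw k
        _ = |γ| * B * regExp γ κ N (x k) := by ring
    rw [norm_smul, Real.norm_eq_abs]
    calc |φ (regSum γ κ h N x j)| * _
        ≤ |φ (regSum γ κ h N x j)| * (|γ| * B * regSum γ κ h N x j) :=
          mul_le_mul_of_nonneg_left h1 (abs_nonneg _)
      _ = |γ| * B * |φ (regSum γ κ h N x j) * regSum γ κ h N x j| := by
          rw [abs_mul, abs_of_nonneg hS]; ring
      _ ≤ |γ| * B * C := mul_le_mul_of_nonneg_left (hφ _) (by positivity)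
  rw [regDeriv, norm_smul, Real.norm_of_nonneg hh]
  refine mul_le_mul_of_nonneg_left ?_ hh
  calc _ ≤ ∑ _j ∈ Finset.range N, |γ| * B * C := norm_sum_le_of_le _ fun j _ => key j
    _ = _ := by simp

theorem abs_regFun_le {γ κ h : ℝ} (hh : 0 ≤ h) {N : ℕ} {Φ : ℝ → ℝ} {C : ℝ}
    (hΦ : ∀ x, |Φ x| ≤ C) (x : ℕ → ℝ) : |regFun γ κ h N Φ x| ≤ h * (N * C) := by
  rw [regFun, abs_mul, abs_of_nonneg hh]
  refine mul_le_mul_of_nonneg_left ?_ hh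
  exact (Finset.abs_sum_le_sum_abs _ _).trans
    ((Finset.sum_le_sum fun j _ => hΦ _).trans (by simp))

/-! ### Riemann sums as integrals, and their limits. -/

variable {γ κ T : ℝ} {u : ℝ → ℝ} {N : ℕ}

theorem regSum_eq_integral {h : ℝ} (hh : 0 < h) (R : ℝ) (j : ℕ) :
    regSum γ κ h R (fun k => u (k * h)) j =
      ∫ s in (0 : ℝ)..(j * h), regExp γ κ R (u (gridLeft h s)) := by
  rw [integral_comp_gridLeft hh (fun s => regExp γ κ R (u s))]
  rfl

theorem regFun_eq_integral (hT : 0 < T) (hN : 0 < N) (Φ : ℝ → ℝ) :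
    regFun γ κ (T / N) N Φ (fun k => u (k * (T / N))) =
      ∫ θ in (0 : ℝ)..T, Φ (∫ s in (0 : ℝ)..gridLeft (T / N) θ,
        regExp γ κ N (u (gridLeft (T / N) s))) := by
  have hN' : (0 : ℝ) < N := mod_cast hN
  have hh : 0 < T / N := div_pos hT hN'
  have h0 := integral_comp_gridLeft hh (fun t => Φ (∫ s in (0 : ℝ)..t,
        regExp γ κ N (u (gridLeft (T / N) s)))) N
  rw [mul_div_cancel₀ _ hN'.ne'] at h0
  rw [h0, smul_eq_mul, regFun]
  simp only [regSum_eq_integral hh]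

theorem regDeriv_eq_integral [CompleteSpace E] (hT : 0 < T) (hN : 0 < N) (φ : ℝ → ℝ)
    (w : ℝ → E) :
    regDeriv γ κ (T / N) N φ (fun k => u (k * (T / N))) (fun k => w (k * (T / N))) =
      ∫ θ in (0 : ℝ)..T, φ (∫ s in (0 : ℝ)..gridLeft (T / N) θ,
        regExp γ κ N (u (gridLeft (T / N) s))) • ∫ s in (0 : ℝ)..gridLeft (T / N) θ,
        (γ * Real.cos (u (gridLeft (T / N) s) / N) * regExp γ κ N (u (gridLeft (T / N) s))) •
          w (gridLeft (T / N) s) := by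
  have hN' : (0 : ℝ) < N := mod_cast hN
  have hh : 0 < T / N := div_pos hT hN'
  have h0 := integral_comp_gridLeft hh (fun t => φ (∫ s in (0 : ℝ)..t,
        regExp γ κ N (u (gridLeft (T / N) s))) • ∫ s in (0 : ℝ)..t,
        (γ * Real.cos (u (gridLeft (T / N) s) / N) * regExp γ κ N (u (gridLeft (T / N) s))) •
          w (gridLeft (T / N) s)) N
  rw [mul_div_cancel₀ _ hN'.ne'] at h0
  rw [h0, regDeriv]
  simp only [regSum_eq_integral hh]
  simp only [fun j => integral_comp_gridLeft hh (fun s => (γ * Real.cos (u s / N) *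
    regExp γ κ N (u s)) • w s) j]

variable {ι : Type*} {l : Filter ι} {n : ι → ℕ}

theorem gridLeft_mem_Icc {h θ : ℝ} (hh : 0 < h) (hθ : θ ∈ Set.Ioc 0 T) :
    gridLeft h θ ∈ Set.Icc 0 T :=
  ⟨gridLeft_nonneg hh θ, (gridLeft_lt hh hθ.1).le.trans hθ.2⟩

theorem tendsto_div_natCast (hn : Tendsto n l atTop) :
    Tendsto (fun i => T / (n i : ℝ)) l (𝓝 0) :=
  (tendsto_natCast_atTop_atTop.comp hn).const_div_atTop T

theorem exists_forall_regExp_le (γ κ T : ℝ) (hu : Continuous u) :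
    ∃ C, ∀ N : ℕ, 0 < N → ∀ s ∈ Set.Icc 0 T, regExp γ κ N (u s) ≤ C := by
  obtain ⟨M, hM⟩ := (isCompact_Icc (a := (0 : ℝ)) (b := T)).exists_bound_of_continuousOn
    hu.continuousOn
  exact ⟨Real.exp (|γ| * M - κ), fun N hN s hs => regExp_le γ κ (mod_cast hN) (hM s hs)⟩

theorem tendsto_integral_regExp [l.IsCountablyGenerated] (hT : 0 < T) (hu : Continuous u)
    (hn : Tendsto n l atTop) (hn0 : ∀ i, 0 < n i) {θ : ℝ} (hθ : θ ∈ Set.Ioc 0 T) :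
    Tendsto (fun i => ∫ s in (0 : ℝ)..gridLeft (T / n i) θ,
      regExp γ κ (n i) (u (gridLeft (T / n i) s))) l
      (𝓝 (∫ s in (0 : ℝ)..θ, Real.exp (γ * u s - κ))) := by
  have hh : ∀ i, 0 < T / (n i : ℝ) := fun i => div_pos hT (mod_cast hn0 i)
  obtain ⟨C, hC⟩ := exists_forall_regExp_le γ κ T hu
  refine tendsto_integral_zero_of_tendsto (T := T) (C := C) ⟨hθ.1.le, hθ.2⟩
    (fun i => gridLeft_mem_Icc (hh i) hθ) (tendsto_gridLeft hh (tendsto_div_natCast hn) hθ.1)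
    (fun i => stronglyMeasurable_comp_gridLeft (fun s => regExp γ κ (n i) (u s)) _)
    (fun i s hs => ?_) (ae_of_all _ fun s hs => ?_)
  · rw [Real.norm_of_nonneg (regExp_pos _ _ _ _).le]
    exact hC _ (hn0 i) _ (gridLeft_mem_Icc (hh i) hs)
  · exact tendsto_regExp γ κ (tendsto_natCast_atTop_atTop.comp hn)
      ((hu.tendsto s).comp (tendsto_gridLeft hh (tendsto_div_natCast hn) hs.1))

theorem tendsto_regFun [l.IsCountablyGenerated] (hT : 0 < T) (hu : Continuous u)
    (hn : Tendsto n l atTop) (hn0 : ∀ i, 0 < n i) {Φ : ℝ → ℝ} (hΦ : Continuous Φ) {C : ℝ} (hC : ∀ x, |Φ x| ≤ C) :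
    Tendsto (fun i => regFun γ κ (T / n i) (n i) Φ (fun k => u (k * (T / n i)))) l
      (𝓝 (∫ θ in (0 : ℝ)..T, Φ (∫ s in (0 : ℝ)..θ, Real.exp (γ * u s - κ)))) := by
  simp only [fun i => regFun_eq_integral (γ := γ) (κ := κ) (u := u) hT (hn0 i) Φ]
  refine intervalIntegral.tendsto_integral_filter_of_dominated_convergence (fun _ => C)
    (Eventually.of_forall fun i => ?_)
    (Eventually.of_forall fun i => ae_of_all _ fun s hs => hC _) intervalIntegrable_const
    (ae_of_all _ fun θ hθ => ?_)
  · exact (stronglyMeasurable_comp_gridLeft (fun t => Φ (∫ s in (0 : ℝ)..t,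
      regExp γ κ (n i) (u (gridLeft (T / n i) s)))) _).aestronglyMeasurable
  · rw [Set.uIoc_of_le hT.le] at hθ
    exact (hΦ.tendsto _).comp (tendsto_integral_regExp hT hu hn hn0 hθ)

/-- The weight may vary with the index and converge only for almost every `s`, under a general
filter. This covers both `1_{[0,s]}` in `ℋ` and the indicators `1_{[0,s]}(r)` with moving `r`, which
fail to converge at the jump. -/
theorem tendsto_regDeriv [l.IsCountablyGenerated] [CompleteSpace E] (hT : 0 < T)
    (hu : Continuous u) (hn : Tendsto n l atTop) (hn0 : ∀ i, 0 < n i) {φ : ℝ → ℝ} (hφ : Continuous φ) {C : ℝ}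
    (hC : ∀ x, |φ x| ≤ C) {w : ι → ℝ → E} {w₀ : ℝ → E} {B : ℝ} (hB : ∀ i s, ‖w i s‖ ≤ B)
    (hw : ∀ᵐ s, s ∈ Set.Ioc 0 T → Tendsto (fun i => w i (gridLeft (T / n i) s)) l (𝓝 (w₀ s))) :
    Tendsto (fun i => regDeriv γ κ (T / n i) (n i) φ (fun k => u (k * (T / n i)))
        fun k => w i (k * (T / n i))) l
      (𝓝 (γ • ∫ θ in (0 : ℝ)..T, φ (∫ s in (0 : ℝ)..θ, Real.exp (γ * u s - κ)) •
        ∫ s in (0 : ℝ)..θ, Real.exp (γ * u s - κ) • w₀ s)) := by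
  have hh : ∀ i, 0 < T / (n i : ℝ) := fun i => div_pos hT (mod_cast hn0 i)
  obtain ⟨D, hD⟩ := exists_forall_regExp_le γ κ T hu
  simp only [fun i => regDeriv_eq_integral (γ := γ) (κ := κ) (u := u) hT (hn0 i) φ (w i)]
  rw [← intervalIntegral.integral_smul]
  have hb : ∀ i, ∀ s ∈ Set.Ioc 0 T, ‖(γ * Real.cos (u (gridLeft (T / n i) s) / n i) *
      regExp γ κ (n i) (u (gridLeft (T / n i) s))) • w i (gridLeft (T / n i) s)‖ ≤
      |γ| * D * B := fun i s hs => by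
    have h1 := hD _ (hn0 i) _ (gridLeft_mem_Icc (hh i) hs)
    have h2 := (regExp_pos γ κ (n i) (u (gridLeft (T / n i) s))).le
    have h3 := Real.abs_cos_le_one (u (gridLeft (T / n i) s) / n i)
    have h4 := hB i (gridLeft (T / n i) s)
    have h5 := h2.trans h1
    rw [norm_smul, Real.norm_eq_abs, abs_mul, abs_mul, abs_of_nonneg h2]
    calc _ ≤ |γ| * 1 * D * B := by gcongr
      _ = _ := by ring
  refine intervalIntegral.tendsto_integral_filter_of_dominated_convergence
    (fun _ => C * (|γ| * D * B * T)) (Eventually.of_forall fun i => ?_)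
    (Eventually.of_forall fun i => ae_of_all _ fun θ hθ => ?_) intervalIntegrable_const
    (ae_of_all _ fun θ hθ => ?_)
  · exact (stronglyMeasurable_comp_gridLeft (fun t => φ (∫ s in (0 : ℝ)..t,
        regExp γ κ (n i) (u (gridLeft (T / n i) s))) • ∫ s in (0 : ℝ)..t,
        (γ * Real.cos (u (gridLeft (T / n i) s) / n i) *
          regExp γ κ (n i) (u (gridLeft (T / n i) s))) • w i (gridLeft (T / n i) s)) _).aestronglyMeasurable
  · rw [Set.uIoc_of_le hT.le] at hθ
    have hp := gridLeft_mem_Icc (hh i) hθ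
    rw [norm_smul]
    refine mul_le_mul (hC _) ?_ (norm_nonneg _) ((abs_nonneg _).trans (hC 0))
    refine (intervalIntegral.norm_integral_le_of_norm_le_const
      (C := |γ| * D * B) fun s hs => hb i s ?_).trans ?_
    · rw [Set.uIoc_of_le hp.1] at hs
      exact ⟨hs.1, hs.2.trans hp.2⟩
    · rw [sub_zero, abs_of_nonneg hp.1]
      exact mul_le_mul_of_nonneg_left hp.2 ((norm_nonneg _).trans (hb i θ hθ))
  · rw [Set.uIoc_of_le hT.le] at hθ
    rw [smul_comm, ← intervalIntegral.integral_smul]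
    refine ((hφ.tendsto _).comp (tendsto_integral_regExp hT hu hn hn0 hθ)).smul ?_
    refine tendsto_integral_zero_of_tendsto (T := T) ⟨hθ.1.le, hθ.2⟩
      (fun i => gridLeft_mem_Icc (hh i) hθ) (tendsto_gridLeft hh (tendsto_div_natCast hn) hθ.1)
      (fun i => stronglyMeasurable_comp_gridLeft (fun s => (γ * Real.cos (u s / n i) *
        regExp γ κ (n i) (u s)) • w i s) _) hb ?_
    filter_upwards [hw] with s hs hs'
    have hus : Tendsto (fun i => u (gridLeft (T / n i) s)) l (𝓝 (u s)) :=
      (hu.tendsto s).comp (tendsto_gridLeft hh (tendsto_div_natCast hn) hs'.1)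
    have hN : Tendsto (fun i => (n i : ℝ)) l atTop := tendsto_natCast_atTop_atTop.comp hn
    -- The cosine left by differentiating the cut-off tends to 1.
    have hcos := (Real.continuous_cos.tendsto 0).comp (hus.div_atTop hN)
    rw [Real.cos_zero] at hcos
    have := ((hcos.const_mul γ).mul (tendsto_regExp γ κ hN hus)).smul (hs hs')
    rw [mul_one, mul_smul] at this
    exact this

end RiemannSum

/-! ### The chaos along a continuous path and its inverse -/

section Path

variable {Ω : Type*} {γ κ : ℝ} {U : ℝ≥0 → Ω → ℝ} {ω : Ω} {T : ℝ}

theorem continuous_path (hω : Continuous fun t => U t ω) :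
    Continuous fun s : ℝ => U s.toNNReal ω :=
  hω.comp continuous_real_toNNReal

theorem continuous_chaosDensity (hω : Continuous fun t => U t ω) :
    Continuous fun s => chaosDensity γ κ U s ω :=
  Real.continuous_exp.comp (((continuous_path hω).const_mul γ).sub continuous_const)

theorem continuous_chaos (hω : Continuous fun t => U t ω) :
    Continuous fun x => chaos γ κ U x ω :=
  intervalIntegral.continuous_primitive
    (fun _ _ => (continuous_chaosDensity hω).intervalIntegrable _ _) 0

theorem chaos_sub_chaos (hω : Continuous fun t => U t ω) (a b : ℝ) :
    chaos γ κ U b ω - chaos γ κ U a ω = ∫ s in a..b, chaosDensity γ κ U s ω :=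
  intervalIntegral.integral_interval_sub_left
    ((continuous_chaosDensity hω).intervalIntegrable _ _)
    ((continuous_chaosDensity hω).intervalIntegrable _ _)

theorem strictMono_chaos (hω : Continuous fun t => U t ω) :
    StrictMono fun x => chaos γ κ U x ω := by
  intro a b hab
  rw [← sub_pos, chaos_sub_chaos hω]
  exact intervalIntegral.intervalIntegral_pos_of_pos
    ((continuous_chaosDensity hω).intervalIntegrable _ _) (fun _ => Real.exp_pos _) hab

theorem chaos_nonneg (hω : Continuous fun t => U t ω) {x : ℝ} (hx : 0 ≤ x) :
    0 ≤ chaos γ κ U x ω := by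
  have := (strictMono_chaos (γ := γ) (κ := κ) hω).monotone hx
  simpa [chaos] using this

/-- If `η(θ) < a`, continuity provides `θ' > θ` still below level `a`. It separates `θ` from the
infimum, also when that is `∞`. -/
theorem lt_chaosInv_iff (hω : Continuous fun t => U t ω) (a : ℝ) (θ : ℝ≥0) :
    (θ : ℝ≥0∞) < chaosInv γ κ U a ω ↔ chaos γ κ U θ ω < a := by
  constructor
  · intro h
    by_contra! h'
    exact (h.trans_le (iInf₂_le θ h')).false
  · intro h
    obtain ⟨θ', hθ, hθ'⟩ : ∃ θ', (θ : ℝ) < θ' ∧ chaos γ κ U θ' ω < a := by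
      have h1 : ∀ᶠ x in 𝓝[>] (θ : ℝ), chaos γ κ U x ω < a :=
        ((continuous_chaos hω).continuousAt.eventually_lt continuousAt_const h).filter_mono
          nhdsWithin_le_nhds
      obtain ⟨x, hx, hx'⟩ := (h1.and self_mem_nhdsWithin).exists
      exact ⟨x, hx', hx⟩
    lift θ' to ℝ≥0 using θ.2.trans hθ.le
    refine (ENNReal.coe_lt_coe.2 (mod_cast hθ : θ < θ')).trans_le (le_iInf₂ fun t ht => ?_)
    have := (strictMono_chaos hω).lt_iff_lt.1 (hθ'.trans_le ht)
    exact_mod_cast this.le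

theorem truncInv_mem_Icc (hT : 0 ≤ T) (a : ℝ) (ω : Ω) : truncInv γ κ U T a ω ∈ Set.Icc 0 T :=
  ⟨ENNReal.toReal_nonneg, ENNReal.toReal_le_of_le_ofReal hT (min_le_right _ _)⟩

theorem lt_truncInv_iff (hω : Continuous fun t => U t ω) (a : ℝ) {θ : ℝ} (h0 : 0 ≤ θ)
    (hθ : θ < T) : θ < truncInv γ κ U T a ω ↔ chaos γ κ U θ ω < a := by
  lift θ to ℝ≥0 using h0
  have hne : min (chaosInv γ κ U a ω) (ENNReal.ofReal T) ≠ ∞ :=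
    ne_top_of_le_ne_top ENNReal.ofReal_ne_top (min_le_right _ _)
  have h1 : (θ : ℝ≥0∞) < ENNReal.ofReal T := by
    rw [← ENNReal.ofReal_coe_nnreal]
    exact (ENNReal.ofReal_lt_ofReal_iff (θ.2.trans_lt hθ)).2 hθ
  rw [← lt_chaosInv_iff hω, truncInv, ← ENNReal.ofReal_lt_iff_lt_toReal θ.coe_nonneg hne, lt_min_iff,
    ENNReal.ofReal_coe_nnreal]
  exact and_iff_left h1

theorem truncInv_eq_integral (hω : Continuous fun t => U t ω) (hT : 0 < T) (a : ℝ) :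
    truncInv γ κ U T a ω =
      ∫ θ in Set.Ioo 0 T, (Set.Ioi (chaos γ κ U θ ω)).indicator (fun _ => (1 : ℝ)) a := by
  have hv := truncInv_mem_Icc (γ := γ) (κ := κ) (U := U) hT.le a ω
  have h1 : Set.EqOn (fun θ => (Set.Ioi (chaos γ κ U θ ω)).indicator (fun _ => (1 : ℝ)) a)
      ((Set.Iio (truncInv γ κ U T a ω)).indicator fun _ => 1) (Set.Ioo 0 T) := fun θ hθ => by
    simp only [Set.indicator_apply, Set.mem_Ioi, Set.mem_Iio, lt_truncInv_iff hω a hθ.1.le hθ.2]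
  rw [setIntegral_congr_fun measurableSet_Ioo h1, setIntegral_indicator measurableSet_Iio,
    Set.Ioo_inter_Iio, min_eq_right hv.2, setIntegral_const]
  simp [hv.1]

theorem ae_chaos_ne (hω : Continuous fun t => U t ω) (a : ℝ) :
    ∀ᵐ θ : ℝ, chaos γ κ U θ ω ≠ a := by
  have h : {θ : ℝ | chaos γ κ U θ ω = a}.Subsingleton := fun x hx y hy =>
    (strictMono_chaos (γ := γ) (κ := κ) hω).injective (Eq.trans hx (Eq.symm hy))
  exact h.countable.ae_notMem volume

/-- The layer-cake integrand is discontinuous at `a` only where `η(θ) = a`, a set of at most one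
point by strict monotonicity. -/
theorem continuous_truncInv (hω : Continuous fun t => U t ω) (hT : 0 < T) :
    Continuous fun a => truncInv γ κ U T a ω := by
  simp only [truncInv_eq_integral hω hT]
  refine continuous_iff_continuousAt.2 fun a => ?_
  refine continuousAt_of_dominated (bound := fun _ => 1) (Eventually.of_forall fun b => ?_)
    (Eventually.of_forall fun b => ae_of_all _ fun θ => ?_) (by simp) ?_
  · have : (fun θ => (Set.Ioi (chaos γ κ U θ ω)).indicator (fun _ => (1 : ℝ)) b) =
        {θ | chaos γ κ U θ ω < b}.indicator fun _ => 1 := by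
      ext θ
      simp [Set.indicator_apply]
    rw [this]
    exact (stronglyMeasurable_const.indicator
      (isOpen_lt (continuous_chaos hω) continuous_const).measurableSet).aestronglyMeasurable
  · simp only [Set.indicator_apply]
    split_ifs <;> simp
  · filter_upwards [ae_restrict_of_ae (ae_chaos_ne hω a)] with θ hθ
    rcases lt_or_gt_of_ne hθ with h | h
    · refine (continuousAt_const (y := (1 : ℝ))).congr ?_
      filter_upwards [Ioi_mem_nhds h] with b hb
      exact (Set.indicator_of_mem (s := Set.Ioi _) hb fun _ => (1 : ℝ)).symm
    · refine (continuousAt_const (y := (0 : ℝ))).congr ?_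
      filter_upwards [Iio_mem_nhds h] with b hb
      exact (Set.indicator_of_notMem (s := Set.Ioi _) (not_lt.2 (le_of_lt hb))
        fun _ => (1 : ℝ)).symm

theorem mollInv_eq_integral (hω : Continuous fun t => U t ω) (hT : 0 < T) {φ : ℝ → ℝ}
    (hφ : Integrable φ) :
    mollInv γ κ U φ T ω = ∫ θ in (0 : ℝ)..T, tailIntegral φ (chaos γ κ U θ ω) := by
  rw [mollInv, intervalIntegral.integral_of_le hT.le, integral_Ioc_eq_integral_Ioo]
  simp only [truncInv_eq_integral hω hT, ← integral_const_mul]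
  rw [integral_integral_swap]
  · refine setIntegral_congr_fun measurableSet_Ioo fun θ hθ => ?_
    have h0 : 0 ≤ chaos γ κ U θ ω := chaos_nonneg hω hθ.1.le
    have h1 : (fun a => φ a * (Set.Ioi (chaos γ κ U θ ω)).indicator (fun _ => (1 : ℝ)) a) =
        (Set.Ioi (chaos γ κ U θ ω)).indicator φ := by
      ext a
      simp [Set.indicator_apply]
    simp only [h1, tailIntegral]
    rw [setIntegral_indicator measurableSet_Ioi, Set.Ioi_inter_Ioi, max_eq_right h0]
  · have h1 : Integrable (fun z : ℝ × ℝ => φ z.1 * (1 : ℝ))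
        ((volume.restrict (Set.Ioi 0)).prod (volume.restrict (Set.Ioo 0 T))) :=
      hφ.integrableOn.mul_prod (integrable_const 1)
    have hS : MeasurableSet {z : ℝ × ℝ | chaos γ κ U z.2 ω < z.1} :=
      (isOpen_lt ((continuous_chaos hω).comp continuous_snd) continuous_fst).measurableSet
    refine (h1.indicator hS).congr (ae_of_all _ fun z => ?_)
    simp [Function.uncurry, Set.indicator_apply]

/-- Both measures give `(a, b]` the length of `(τ_a ∧ T, τ_b ∧ T]`. Continuity of the truncated
inverse removes the right limits in the Stieltjes measure. -/
theorem invMeasure_eq_map (hω : Continuous fun t => U t ω) (hT : 0 < T) :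
    invMeasure γ κ U T ω =
      (volume.restrict (Set.Ioc 0 T)).map fun θ => chaos γ κ U θ ω := by
  have hc := continuous_truncInv (γ := γ) (κ := κ) hω hT
  unfold invMeasure
  refine Measure.ext_of_Ioc _ _ fun a b hab => ?_
  rw [StieltjesFunction.measure_Ioc, Measure.map_apply (continuous_chaos hω).measurable
    measurableSet_Ioc, Measure.restrict_apply ((continuous_chaos hω).measurable
    measurableSet_Ioc)]
  simp only [Monotone.stieltjesFunction_eq]
  rw [hc.continuousAt.continuousWithinAt.rightLim_eq, hc.continuousAt.continuousWithinAt.rightLim_eq,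
    ← Real.volume_Ioc]
  refine measure_congr ?_
  -- Discarding finitely many `θ` makes all the comparisons strict, so open and closed ends need no
  -- care.
  have hne : ∀ c : ℝ, ∀ᵐ θ : ℝ, θ ≠ c := fun c => Measure.ae_ne volume c
  filter_upwards [ae_chaos_ne (γ := γ) (κ := κ) hω a, ae_chaos_ne (γ := γ) (κ := κ) hω b, hne T,
    hne (truncInv γ κ U T a ω), hne (truncInv γ κ U T b ω)] with θ h1 h2 h3 h4 h5
  have ha := truncInv_mem_Icc (γ := γ) (κ := κ) (U := U) hT.le a ω
  have hb := truncInv_mem_Icc (γ := γ) (κ := κ) (U := U) hT.le b ω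
  refine propext ?_
  change θ ∈ Set.Ioc _ _ ↔ θ ∈ (_ : Set ℝ) ∩ _
  simp only [Set.mem_Ioc, Set.mem_inter_iff, Set.mem_preimage]
  by_cases hθ : 0 < θ ∧ θ < T
  · have ia := lt_truncInv_iff (γ := γ) (κ := κ) hω a hθ.1.le hθ.2
    have ib := lt_truncInv_iff (γ := γ) (κ := κ) hω b hθ.1.le hθ.2
    constructor
    · rintro ⟨q1, q2⟩
      refine ⟨⟨?_, (ib.1 (lt_of_le_of_ne q2 h5)).le⟩, hθ.1, hθ.2.le⟩
      exact lt_of_le_of_ne (not_lt.1 (mt ia.2 (not_lt.2 q1.le))) h1.symm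
    · rintro ⟨⟨q1, q2⟩, -⟩
      refine ⟨?_, (ib.2 (lt_of_le_of_ne q2 h2)).le⟩
      exact lt_of_le_of_ne (not_lt.1 (mt ia.1 (not_lt.2 q1.le))) h4.symm
  · constructor
    · rintro ⟨q1, q2⟩
      exact absurd ⟨ha.1.trans_lt q1, lt_of_le_of_ne (q2.trans hb.2) h3⟩ hθ
    · rintro ⟨-, q1, q2⟩
      exact absurd ⟨q1, lt_of_le_of_ne q2 h3⟩ hθ

theorem chaos_max_sub_chaos (hω : Continuous fun t => U t ω) {r θ : ℝ} (hr : 0 ≤ r)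
    (hθ : 0 ≤ θ) :
    chaos γ κ U (max θ r) ω - chaos γ κ U r ω =
      ∫ s in (0 : ℝ)..θ, (Set.Icc 0 s).indicator 1 r * chaosDensity γ κ U s ω := by
  have h1 : ∫ s in (0 : ℝ)..θ, (Set.Icc 0 s).indicator 1 r * chaosDensity γ κ U s ω =
      ∫ s in Set.Ioc 0 θ ∩ Set.Ici r, chaosDensity γ κ U s ω := by
    rw [intervalIntegral.integral_of_le hθ, ← setIntegral_indicator measurableSet_Ici]
    congr 1
    ext s
    simp [Set.indicator_apply, hr]
  rw [h1, chaos_sub_chaos hω, intervalIntegral.integral_of_le (le_max_right _ _)]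
  refine setIntegral_congr_set ?_
  filter_upwards [Measure.ae_ne volume r] with s hs
  refine propext ?_
  change s ∈ Set.Ioc _ _ ↔ s ∈ (_ : Set ℝ) ∩ _
  simp only [Set.mem_Ioc, Set.mem_inter_iff, Set.mem_Ici, le_max_iff]
  constructor
  · rintro ⟨q1, q2⟩
    exact ⟨⟨hr.trans_lt q1, q2.resolve_right (not_le.2 q1)⟩, q1.le⟩
  · rintro ⟨⟨q1, q2⟩, q3⟩
    exact ⟨lt_of_le_of_ne q3 hs.symm, Or.inl q2⟩

/-- Substitution `y = η(θ)`; the part `θ ≤ r` contributes nothing because `max θ r = r` there. -/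
theorem integral_comp_chaos_eq (hω : Continuous fun t => U t ω) (hT : 0 < T) {φ : ℝ → ℝ}
    (hφ : Continuous φ) {r : ℝ} (hr : 0 ≤ r) (hrT : r ≤ T) :
    ∫ θ in (0 : ℝ)..T, φ (chaos γ κ U θ ω) * (chaos γ κ U (max θ r) ω - chaos γ κ U r ω) =
      ∫ y in (chaos γ κ U r ω)..(chaos γ κ U T ω), φ y * (y - chaos γ κ U r ω)
        ∂(invMeasure γ κ U T ω) := by
  have hc := continuous_chaos (γ := γ) (κ := κ) hω
  have hm := strictMono_chaos (γ := γ) (κ := κ) hω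
  rw [intervalIntegral.integral_of_le (hm.monotone hrT), invMeasure_eq_map hω hT,
    setIntegral_map measurableSet_Ioc (by fun_prop) hc.aemeasurable,
    Measure.restrict_restrict (hc.measurable measurableSet_Ioc)]
  have hset : (fun θ => chaos γ κ U θ ω) ⁻¹' Set.Ioc (chaos γ κ U r ω) (chaos γ κ U T ω) ∩
      Set.Ioc 0 T = Set.Ioc r T := by
    ext θ
    simp only [Set.mem_inter_iff, Set.mem_preimage, Set.mem_Ioc, hm.lt_iff_lt, hm.le_iff_le]
    exact ⟨fun h => h.1, fun h => ⟨h, hr.trans_lt h.1, h.2⟩⟩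
  rw [hset, ← intervalIntegral.integral_of_le hrT]
  have hint : ∀ a b, IntervalIntegrable (fun θ => φ (chaos γ κ U θ ω) *
      (chaos γ κ U (max θ r) ω - chaos γ κ U r ω)) volume a b := fun a b =>
    ((hφ.comp hc).mul ((hc.comp (continuous_id.max continuous_const)).sub
      continuous_const)).intervalIntegrable a b
  rw [← intervalIntegral.integral_add_adjacent_intervals (hint 0 r) (hint r T)]
  have h0 : ∫ θ in (0 : ℝ)..r, φ (chaos γ κ U θ ω) *
      (chaos γ κ U (max θ r) ω - chaos γ κ U r ω) = 0 := by
    rw [intervalIntegral.integral_congr (g := fun _ => 0), intervalIntegral.integral_zero]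
    intro θ hθ
    rw [Set.uIcc_of_le hr] at hθ
    simp [max_eq_right hθ.2]
  rw [h0, zero_add]
  refine intervalIntegral.integral_congr fun θ hθ => ?_
  rw [Set.uIcc_of_le hrT] at hθ
  simp only [max_eq_left hθ.1]

end Path

/-! ### The elements `1_{[0,t]}` of `ℋ` -/

theorem HilbertH.inner_ind (K : CovKernel) (s t : ℝ≥0) :
    inner ℝ (HilbertH.ind K s) (HilbertH.ind K t) = K.toFun s t := by
  rw [HilbertH.ind, HilbertH.ind, UniformSpace.Completion.inner_coe]
  change K.form (Finsupp.single s 1) (Finsupp.single t 1) = _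
  simp [CovKernel.form]

theorem HilbertH.norm_ind (K : CovKernel) (t : ℝ≥0) :
    ‖HilbertH.ind K t‖ = √(K.toFun t t) := by
  rw [norm_eq_sqrt_real_inner, HilbertH.inner_ind]

theorem HilbertH.norm_ind_sub_ind_sq (K : CovKernel) (s t : ℝ≥0) :
    ‖HilbertH.ind K s - HilbertH.ind K t‖ ^ 2 =
      K.toFun s s - 2 * K.toFun s t + K.toFun t t := by
  rw [norm_sub_sq_real, HilbertH.inner_ind, ← real_inner_self_eq_norm_sq,
    ← real_inner_self_eq_norm_sq, HilbertH.inner_ind, HilbertH.inner_ind]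

theorem logCov_of_le {ε δ d : ℝ} (hd : d ≤ ε) :
    logCov ε δ d = Real.log (δ / ε) - (1 / ε - 1 / δ) * d := if_pos hd

section LogKernel

variable {ε δ : ℝ} (hε : 0 < ε) (hδ : ε < δ)

theorem norm_ind_logKernel (t : ℝ≥0) :
    ‖HilbertH.ind (logKernel hε hδ) t‖ = √(Real.log (δ / ε)) := by
  rw [HilbertH.norm_ind]
  congr 1
  change logCov ε δ |(t : ℝ) - t| = _
  rw [sub_self, abs_zero, logCov_of_le hε.le, mul_zero, sub_zero]

/-- The covariance is linear in the distance up to `ε`, so the squared distance in `ℋ` is `2 (1/ε -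
1/δ) |t - s|` there. -/
theorem continuous_ind_logKernel : Continuous (HilbertH.ind (logKernel hε hδ)) := by
  refine continuous_iff_continuousAt.2 fun t => ?_
  rw [ContinuousAt, tendsto_iff_norm_sub_tendsto_zero]
  have hc : Tendsto (fun s : ℝ≥0 => |(t : ℝ) - s|) (𝓝 t) (𝓝 0) := by
    have : Continuous fun s : ℝ≥0 => |(t : ℝ) - s| := by fun_prop
    simpa using this.tendsto t
  have h1 : Tendsto (fun s : ℝ≥0 => √(2 * ((1 / ε - 1 / δ) * |(t : ℝ) - s|))) (𝓝 t) (𝓝 0) := by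
    simpa using ((hc.const_mul (1 / ε - 1 / δ)).const_mul 2).sqrt
  refine h1.congr' ?_
  filter_upwards [hc.eventually_le_const hε] with s hs
  rw [← Real.sqrt_sq (norm_nonneg (HilbertH.ind (logKernel hε hδ) s - _)),
    HilbertH.norm_ind_sub_ind_sq]
  congr 1
  change _ = logCov ε δ |(s : ℝ) - s| - 2 * logCov ε δ |(t : ℝ) - s| + logCov ε δ |(t : ℝ) - t|
  rw [sub_self, sub_self, abs_zero, logCov_of_le hε.le, logCov_of_le hs]
  ring

end LogKernel

variable {K : CovKernel}

/-- Evaluation of step functions at `r`, as a linear map. -/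
def StepFun.evalLin (K : CovKernel) (r : ℝ≥0) : StepFun K →ₗ[ℝ] ℝ :=
  (Finsupp.linearCombination ℝ fun t : ℝ≥0 => (Set.Icc 0 t).indicator (1 : ℝ≥0 → ℝ) r :
    (ℝ≥0 →₀ ℝ) →ₗ[ℝ] ℝ)

theorem StepFun.evalLin_apply (r : ℝ≥0) (c : StepFun K) : StepFun.evalLin K r c = c.eval r := rfl

theorem StepFun.eval_ind (t r : ℝ≥0) :
    (StepFun.ind K t).eval r = (Set.Icc 0 t).indicator 1 r := by
  rw [StepFun.eval, StepFun.ind]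
  simp

/-! ### Smooth cylindrical Riemann sums -/

section Cylindrical

variable {n : ℕ} {γ κ h : ℝ} {Φ φ : ℝ → ℝ}

/-- `Fin.ofNat` reduces indices modulo `n + 1`, so that sequences on `ℕ` can be used; the sums only
see `k < n + 1`, where it changes nothing. -/
theorem hasFDerivAt_regFun (hΦ : Differentiable ℝ Φ) (x : Fin (n + 1) → ℝ) :
    HasFDerivAt (fun x : Fin (n + 1) → ℝ =>
        regFun γ κ h (n + 1 : ℕ) Φ fun k => x (Fin.ofNat (n + 1) k))
      (regDeriv γ κ h (n + 1 : ℕ) (deriv Φ) (fun k => x (Fin.ofNat (n + 1) k))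
        fun k => ContinuousLinearMap.proj (R := ℝ) (φ := fun _ : Fin (n + 1) => ℝ)
          (Fin.ofNat (n + 1) k)) x := by
  have hpos : (0 : ℝ) < (n + 1 : ℕ) := by positivity
  unfold regFun regDeriv
  refine HasFDerivAt.const_mul (HasFDerivAt.fun_sum fun j _ => ?_) h
  refine (hΦ _).hasDerivAt.comp_hasFDerivAt x ?_
  unfold regSum
  refine HasFDerivAt.const_mul (HasFDerivAt.fun_sum fun k _ => ?_) h
  have hk := (hasDerivAt_regExp γ κ hpos (x (Fin.ofNat (n + 1) k))).comp_hasFDerivAt x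
    (hasFDerivAt_apply (𝕜 := ℝ) (Fin.ofNat (n + 1) k) x)
  exact hk

theorem smoothBounded_regFun (hΦ : SmoothBounded Φ) :
    SmoothBounded fun x : Fin (n + 1) → ℝ =>
      regFun γ κ h (n + 1 : ℕ) Φ fun k => x (Fin.ofNat (n + 1) k) := by
  have hpos : (0 : ℝ) < (n + 1 : ℕ) := by positivity
  refine (SmoothBounded.sum _ fun j _ => hΦ.comp ?_).const_smul h
  exact (SmoothBounded.sum _ fun k _ => (smoothBounded_regExp γ κ hpos).comp_clm
    (ContinuousLinearMap.proj (R := ℝ) (φ := fun _ : Fin (n + 1) => ℝ)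
      (Fin.ofNat (n + 1) k))).const_smul h

variable {Ω : Type*} [MeasurableSpace Ω] {P : Measure Ω} {X : ℝ≥0 → Ω → ℝ}

theorem wiener_ind (hX : IsCenteredGaussian K X P) (t : ℝ≥0) :
    wiener hX (HilbertH.ind K t) =ᵐ[P] X t := by
  have h1 : wiener hX (HilbertH.ind K t) = wienerStep hX (StepFun.ind K t) :=
    ContinuousLinearMap.extend_eq (wienerStep hX).toContinuousLinearMap
      (e := UniformSpace.Completion.toComplL) UniformSpace.Completion.denseRange_coe
      (UniformSpace.Completion.isUniformInducing_coe _) (StepFun.ind K t)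
  have h2 : wienerStep hX (StepFun.ind K t) = (hX.memLp t).toLp (X t) :=
    (Finsupp.linearCombination_single ℝ (1 : ℝ) t).trans (one_smul ℝ _)
  rw [h1, h2]
  exact (hX.memLp t).coeFn_toLp

theorem mem_cylGraph_regFun (hX : IsCenteredGaussian K X P) (hΦ : SmoothBounded Φ)
    (t : ℕ → ℝ≥0)
    (hF : MemLp (fun ω => regFun γ κ h (n + 1 : ℕ) Φ fun k => X (t k) ω) 2 P)
    (hD : MemLp (fun ω => regDeriv γ κ h (n + 1 : ℕ) (deriv Φ) (fun k => X (t k) ω)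
      fun k => HilbertH.ind K (t k)) 2 P) :
    (hF.toLp _, hD.toLp _) ∈ cylGraph hX := by
  have hmod : ∀ k < n + 1, ((Fin.ofNat (n + 1) k : Fin (n + 1)) : ℕ) = k := fun k hk =>
    Nat.mod_eq_of_lt hk
  have hw : ∀ᵐ ω ∂P, ∀ i : Fin (n + 1), wiener hX (HilbertH.ind K (t i)) ω = X (t i) ω :=
    ae_all_iff.2 fun i => wiener_ind hX (t i)
  refine ⟨n + 1, fun x => regFun γ κ h (n + 1 : ℕ) Φ fun k => x (Fin.ofNat (n + 1) k),
    fun i => HilbertH.ind K (t i), by omega, smoothBounded_regFun hΦ, ?_, ?_⟩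
  · filter_upwards [hF.coeFn_toLp, hw] with ω h1 h2
    refine h1.trans (regFun_congr fun k hk => ?_)
    rw [h2, hmod k hk]
  · filter_upwards [hD.coeFn_toLp, hw] with ω h1 h2
    have hd : Differentiable ℝ Φ := hΦ.1.differentiable (by simp)
    refine h1.trans ?_
    simp only [h2]
    rw [(hasFDerivAt_regFun hd _).fderiv]
    -- The linear map `L ↦ ∑ᵢ L(eᵢ) 1_{[0,tᵢ]}` carries the Fréchet derivative to the Malliavin
    -- derivative, and the `k`-th projection to `1_{[0,t_k]}`.
    have h3 := map_regDeriv (∑ i : Fin (n + 1),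
      ((ContinuousLinearMap.apply ℝ ℝ (Pi.single i 1 : Fin (n + 1) → ℝ)).toLinearMap).smulRight
        (HilbertH.ind K (t i))) γ κ h (n + 1) (deriv Φ)
      (fun k => X (t (Fin.ofNat (n + 1) k : Fin (n + 1))) ω)
      fun k => ContinuousLinearMap.proj (R := ℝ) (φ := fun _ : Fin (n + 1) => ℝ)
          (Fin.ofNat (n + 1) k)
    simp only [LinearMap.sum_apply, LinearMap.smulRight_apply, ContinuousLinearMap.coe_coe,
      ContinuousLinearMap.apply_apply] at h3
    rw [h3]
    refine regDeriv_congr (fun k hk => by rw [hmod k hk]) fun k hk => ?_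
    rw [Finset.sum_eq_single (Fin.ofNat (n + 1) k)]
    · rw [hmod k hk]
      simp
    · intro i _ hi
      rw [ContinuousLinearMap.proj_apply, Pi.single_eq_of_ne hi.symm, zero_smul]
    · simp

theorem aestronglyMeasurable_regFun (hX : IsCenteredGaussian K X P) (hΦ : Continuous Φ)
    (N : ℕ) (t : ℕ → ℝ≥0) :
    AEStronglyMeasurable (fun ω => regFun γ κ h N Φ fun k => X (t k) ω) P := by
  have hm : AEMeasurable (fun ω k => X (t k) ω) P :=
    aemeasurable_pi_lambda _ fun k => (hX.memLp (t k)).aestronglyMeasurable.aemeasurable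
  have hc : Continuous (regFun γ κ h N Φ) := by
    unfold regFun regSum regExp
    fun_prop
  exact (hc.measurable.comp_aemeasurable hm).aestronglyMeasurable

theorem aestronglyMeasurable_regDeriv (hX : IsCenteredGaussian K X P) (hφ : Continuous φ)
    (N : ℕ) (t : ℕ → ℝ≥0) (w : ℕ → HilbertH K) :
    AEStronglyMeasurable (fun ω => regDeriv γ κ h N φ (fun k => X (t k) ω) w) P := by
  have hm : AEStronglyMeasurable (fun ω k => X (t k) ω) P :=
    (aemeasurable_pi_lambda _ fun k =>
      (hX.memLp (t k)).aestronglyMeasurable.aemeasurable).aestronglyMeasurable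
  exact (continuous_regDeriv hφ N w).comp_aestronglyMeasurable hm

end Cylindrical

/-! ### Passage to the limit in `L²` -/

section Limit

variable {Ω : Type*} [MeasurableSpace Ω] {P : Measure Ω} [IsProbabilityMeasure P]

theorem exists_memLp_tendsto_toLp {E : Type*} [NormedAddCommGroup E] {f : ℕ → Ω → E} {g : Ω → E}
    {C : ℝ} (hf : ∀ n, AEStronglyMeasurable (f n) P) (hC : ∀ n ω, ‖f n ω‖ ≤ C)
    (hfg : ∀ᵐ ω ∂P, Tendsto (fun n => f n ω) atTop (𝓝 (g ω))) :
    ∃ (hf2 : ∀ n, MemLp (f n) 2 P) (hg2 : MemLp g 2 P),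
      Tendsto (fun n => (hf2 n).toLp (f n)) atTop (𝓝 (hg2.toLp g)) := by
  have hf2 : ∀ n, MemLp (f n) 2 P := fun n => MemLp.of_bound (hf n) C (ae_of_all _ (hC n))
  have hg2 : MemLp g 2 P := by
    refine MemLp.of_bound (aestronglyMeasurable_of_tendsto_ae atTop hf hfg) C ?_
    filter_upwards [hfg] with ω hω
    exact le_of_tendsto hω.norm (Eventually.of_forall fun n => hC n ω)
  refine ⟨hf2, hg2, (Lp.tendsto_Lp_iff_tendsto_eLpNorm'' f hf2 g hg2).2 ?_⟩
  refine tendsto_Lp_finite_of_tendsto_ae (by norm_num) (by norm_num) hf hg2 ?_ hfg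
  -- Above the threshold `C + 1` the tail sets are empty, so uniform integrability is immediate and
  -- Vitali's theorem applies.
  refine unifIntegrable_of (by norm_num) (by norm_num) hf fun ε _ => ⟨C.toNNReal + 1, fun n => ?_⟩
  have : {x | C.toNNReal + 1 ≤ ‖f n x‖₊} = ∅ := by
    refine Set.eq_empty_iff_forall_notMem.2 fun x hx => ?_
    have h1 : ((C.toNNReal + 1 : ℝ≥0) : ℝ) ≤ ‖f n x‖ := hx
    have h2 := Real.le_coe_toNNReal C
    push_cast at h1
    linarith [hC n x]
  simp [this]

theorem HasMalliavinDeriv.of_tendsto {X : ℝ≥0 → Ω → ℝ} (hX : IsCenteredGaussian K X P)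
    {F : ℕ → Ω → ℝ} {D : ℕ → Ω → HilbertH K} {F₀ : Ω → ℝ} {D₀ : Ω → HilbertH K} {A B : ℝ}
    (hF : ∀ n, AEStronglyMeasurable (F n) P) (hD : ∀ n, AEStronglyMeasurable (D n) P)
    (hA : ∀ n ω, ‖F n ω‖ ≤ A) (hB : ∀ n ω, ‖D n ω‖ ≤ B)
    (hF₀ : ∀ᵐ ω ∂P, Tendsto (fun n => F n ω) atTop (𝓝 (F₀ ω)))
    (hD₀ : ∀ᵐ ω ∂P, Tendsto (fun n => D n ω) atTop (𝓝 (D₀ ω)))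
    (hcyl : ∀ n (hF : MemLp (F n) 2 P) (hD : MemLp (D n) 2 P),
      (hF.toLp _, hD.toLp _) ∈ cylGraph hX) : HasMalliavinDeriv hX F₀ D₀ := by
  obtain ⟨hF2, hF02, hFt⟩ := exists_memLp_tendsto_toLp hF hA hF₀
  obtain ⟨hD2, hD02, hDt⟩ := exists_memLp_tendsto_toLp hD hB hD₀
  exact ⟨hF02, hD02, mem_closure_of_tendsto (hFt.prodMk_nhds hDt)
    (Eventually.of_forall fun n => hcyl n (hF2 n) (hD2 n))⟩

end Limit

/-! ### Convergence of the Riemann sums along the field -/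

section Field

variable {Ω : Type*} {γ κ T : ℝ} {U : ℝ≥0 → Ω → ℝ} {ω : Ω} {φ : ℝ → ℝ}

/-- The grid point `k T / (n + 1)`. -/
def gridPoint (T : ℝ) (n k : ℕ) : ℝ≥0 := (k * (T / (n + 1 : ℕ))).toNNReal

theorem tendsto_indicator_Icc_prod {r : ℝ≥0} {p : ℕ → ℝ} {s : ℝ} (hs : s ≠ r)
    (hp0 : ∀ n, 0 ≤ p n) (hp : Tendsto p atTop (𝓝 s)) :
    Tendsto (fun i : ℕ × ℝ≥0 => (Set.Icc 0 (p i.1).toNNReal).indicator (1 : ℝ≥0 → ℝ) i.2)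
      (atTop ×ˢ 𝓝 r) (𝓝 ((Set.Icc 0 s).indicator 1 (r : ℝ))) := by
  have hp' : Tendsto (fun i : ℕ × ℝ≥0 => p i.1) (atTop ×ˢ 𝓝 r) (𝓝 s) := hp.comp tendsto_fst
  have hr' : Tendsto (fun i : ℕ × ℝ≥0 => (i.2 : ℝ)) (atTop ×ˢ 𝓝 r) (𝓝 (r : ℝ)) :=
    (NNReal.continuous_coe.tendsto r).comp tendsto_snd
  refine tendsto_const_nhds.congr' ?_
  rcases lt_or_gt_of_ne hs with h | h
  · filter_upwards [hp'.eventually_lt hr' h] with i hi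
    rw [Set.indicator_of_notMem fun h' => (h.trans_le h'.2).false, Set.indicator_of_notMem]
    rintro ⟨-, h'⟩
    exact (hi.trans_le ((NNReal.coe_le_coe.2 h').trans_eq
      (Real.coe_toNNReal _ (hp0 _)))).false
  · filter_upwards [hr'.eventually_lt hp' h] with i hi
    rw [Set.indicator_of_mem, Set.indicator_of_mem]
    · rfl
    · exact ⟨zero_le, NNReal.le_toNNReal_of_coe_le hi.le⟩
    · exact ⟨r.coe_nonneg, h.le⟩

theorem continuous_integral_chaos_max (hω : Continuous fun t => U t ω) (hφ : Continuous φ) :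
    Continuous fun r : ℝ≥0 => γ * ∫ θ in (0 : ℝ)..T, φ (chaos γ κ U θ ω) *
      (chaos γ κ U (max θ r) ω - chaos γ κ U r ω) := by
  have hc := continuous_chaos (γ := γ) (κ := κ) hω
  refine continuous_const.mul
    (intervalIntegral.continuous_parametric_intervalIntegral_of_continuous' ?_ 0 T)
  simp only [Function.uncurry_def]
  exact (hφ.comp (hc.comp continuous_snd)).mul
    ((hc.comp (continuous_snd.max (NNReal.continuous_coe.comp continuous_fst))).sub
      (hc.comp (NNReal.continuous_coe.comp continuous_fst)))

theorem integral_chaos_max_eq (hω : Continuous fun t => U t ω) (hT : 0 < T) (φ : ℝ → ℝ)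
    (r : ℝ≥0) :
    ∫ θ in (0 : ℝ)..T, φ (chaos γ κ U θ ω) *
        (chaos γ κ U (max θ r) ω - chaos γ κ U r ω) =
      ∫ θ in (0 : ℝ)..T, φ (chaos γ κ U θ ω) *
        ∫ s in (0 : ℝ)..θ, (Set.Icc 0 s).indicator 1 (r : ℝ) * chaosDensity γ κ U s ω := by
  refine intervalIntegral.integral_congr fun θ hθ => ?_
  rw [Set.uIcc_of_le hT.le] at hθ
  simp only [chaos_max_sub_chaos hω r.coe_nonneg hθ.1]

theorem eval_regDeriv (K : CovKernel) (γ κ h : ℝ) (N : ℕ) (φ : ℝ → ℝ) (x : ℕ → ℝ)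
    (t : ℕ → ℝ≥0) (r : ℝ≥0) :
    (regDeriv γ κ h N φ x fun k => StepFun.ind K (t k)).eval r =
      regDeriv γ κ h N φ x fun k => (Set.Icc 0 (t k)).indicator (1 : ℝ≥0 → ℝ) r := by
  rw [← StepFun.evalLin_apply, map_regDeriv]
  simp only [StepFun.evalLin_apply, StepFun.eval_ind]

/-- Convergence is along `n → ∞` and `r' → r` jointly. This continuous convergence is what yields
uniform convergence on compact sets. -/
theorem tendsto_regDeriv_indicator (hω : Continuous fun t => U t ω)
    (hT : 0 < T) (hφ : Continuous φ) {C : ℝ} (hC : ∀ x, |φ x| ≤ C) (r : ℝ≥0) :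
    Tendsto (fun i : ℕ × ℝ≥0 => regDeriv γ κ (T / (i.1 + 1 : ℕ)) (i.1 + 1) φ
        (fun k => U (gridPoint T i.1 k) ω)
        fun k => (Set.Icc 0 (gridPoint T i.1 k)).indicator (1 : ℝ≥0 → ℝ) i.2)
      (atTop ×ˢ 𝓝 r) (𝓝 (γ * ∫ θ in (0 : ℝ)..T, φ (chaos γ κ U θ ω) *
        (chaos γ κ U (max θ r) ω - chaos γ κ U r ω))) := by
  have hh : ∀ n : ℕ, 0 < T / (n + 1 : ℕ) := fun n => div_pos hT (by positivity)
  have hn : Tendsto (fun i : ℕ × ℝ≥0 => i.1 + 1) (atTop ×ˢ 𝓝 r) atTop :=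
    (tendsto_add_atTop_nat 1).comp tendsto_fst
  have h := tendsto_regDeriv (γ := γ) (κ := κ) (B := 1) hT (continuous_path hω) hn
    (fun i => Nat.succ_pos _) hφ hC
    (w := fun i s => (Set.Icc 0 s.toNNReal).indicator (1 : ℝ≥0 → ℝ) i.2)
    (w₀ := fun s => (Set.Icc 0 s).indicator 1 (r : ℝ)) (fun i s => ?_) ?_
  · rw [integral_chaos_max_eq hω hT]
    simp only [smul_eq_mul, mul_comm (Real.exp _)] at h
    simp only [chaos, chaosDensity, gridPoint]
    exact h
  · simp only [Set.indicator_apply]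
    split_ifs <;> simp
  · filter_upwards [Measure.ae_ne volume (r : ℝ)] with s hs hs'
    exact tendsto_indicator_Icc_prod (p := fun n : ℕ => gridLeft (T / (n + 1 : ℕ)) s) hs
      (fun n => gridLeft_nonneg (hh n) s)
      (tendsto_gridLeft hh (tendsto_div_natCast (tendsto_add_atTop_nat 1)) hs'.1)

theorem tendstoUniformly_eval_regDeriv (K : CovKernel) (hω : Continuous fun t => U t ω)
    (hT : 0 < T) (hφ : Continuous φ) {C : ℝ} (hC : ∀ x, |φ x| ≤ C) :
    TendstoUniformly (fun n => (regDeriv γ κ (T / (n + 1 : ℕ)) (n + 1) φ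
        (fun k => U (gridPoint T n k) ω) fun k => StepFun.ind K (gridPoint T n k)).eval)
      (fun r : ℝ≥0 => γ * ∫ θ in (0 : ℝ)..T, φ (chaos γ κ U θ ω) *
        (chaos γ κ U (max θ r) ω - chaos γ κ U r ω)) atTop := by
  have hh : ∀ n : ℕ, 0 < T / (n + 1 : ℕ) := fun n => div_pos hT (by positivity)
  have hcomp : TendstoUniformlyOn (fun n => (regDeriv γ κ (T / (n + 1 : ℕ)) (n + 1) φ
        (fun k => U (gridPoint T n k) ω) fun k => StepFun.ind K (gridPoint T n k)).eval)
      (fun r : ℝ≥0 => γ * ∫ θ in (0 : ℝ)..T, φ (chaos γ κ U θ ω) *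
        (chaos γ κ U (max θ r) ω - chaos γ κ U r ω)) atTop (Set.Icc 0 T.toNNReal) := by
    rw [← tendstoLocallyUniformlyOn_iff_tendstoUniformlyOn_of_compact isCompact_Icc,
      tendstoLocallyUniformlyOn_iff_forall_tendsto]
    intro r _
    -- Limit function and approximation, both at the moving point, tend to the same value, so their
    -- pair enters every entourage.
    have h1 := ((((continuous_integral_chaos_max (T := T) (γ := γ) (κ := κ) hω hφ).tendsto r).comp
      (tendsto_snd (f := (atTop : Filter ℕ)))).prodMk_nhds (tendsto_regDeriv_indicator hω hT hφ hC r)).mono_right (nhds_le_uniformity _)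
    simp only [eval_regDeriv]
    exact h1.mono_left (Filter.prod_mono_right _ nhdsWithin_le_nhds)
  rw [Metric.tendstoUniformly_iff]
  intro e he
  filter_upwards [Metric.tendstoUniformlyOn_iff.1 hcomp e he] with n hn r
  rcases le_or_gt r T.toNNReal with hr | hr
  · exact hn r ⟨zero_le, hr⟩
  · have hTr : T < r := (Real.le_coe_toNNReal T).trans_lt (NNReal.coe_lt_coe.2 hr)
    have h1 : ∫ θ in (0 : ℝ)..T, φ (chaos γ κ U θ ω) *
        (chaos γ κ U (max θ r) ω - chaos γ κ U r ω) = 0 := by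
      rw [intervalIntegral.integral_congr (g := fun _ => 0), intervalIntegral.integral_zero]
      intro θ hθ
      rw [Set.uIcc_of_le hT.le] at hθ
      simp [max_eq_right (hθ.2.trans hTr.le)]
    have h2 : ∀ k < n + 1, (Set.Icc 0 (gridPoint T n k)).indicator (1 : ℝ≥0 → ℝ) r = 0 := by
      intro k hk
      refine Set.indicator_of_notMem (fun h => ?_) _
      refine (h.2.trans_lt' hr).not_ge (Real.toNNReal_le_toNNReal ?_)
      have : (k : ℝ) ≤ (n + 1 : ℕ) := mod_cast hk.le
      calc (k : ℝ) * (T / (n + 1 : ℕ)) ≤ (n + 1 : ℕ) * (T / (n + 1 : ℕ)) :=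
            mul_le_mul_of_nonneg_right this (hh n).le
        _ = T := mul_div_cancel₀ _ (by positivity)
    rw [h1, eval_regDeriv, regDeriv_congr (fun _ _ => rfl) h2]
    simpa [regDeriv] using he

end Field

theorem deriv_tailIntegral {φ : ℝ → ℝ} (hφ : Continuous φ) (hφc : HasCompactSupport φ) :
    deriv (tailIntegral φ) = -φ :=
  funext fun x =>
    (hasDerivAt_tailIntegral hφ (hφ.integrable_of_hasCompactSupport hφc) x).deriv

end

end GaussMalliavin

/-! ### Assembly of the theorem. -/

theorem mainTheorem5 {Ω : Type*} [MeasurableSpace Ω] (P : Measure Ω) [IsProbabilityMeasure P]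
    {ε δ : ℝ} (hε : 0 < ε) (hδ : ε < δ)
    (U : ℝ≥0 → Ω → ℝ) (hU : IsCenteredGaussian (logKernel hε hδ) U P)
    (hcont : ∀ᵐ ω ∂P, Continuous fun t => U t ω)
    (γ κ : ℝ) (φ : ℝ → ℝ) (hφ : ContDiff ℝ (⊤ : ℕ∞) φ) (hφ0 : ∀ x, 0 ≤ φ x)
    (hφc : HasCompactSupport φ) (hφs : tsupport φ ⊆ Set.Ioi 0) (T : ℝ) (hT : 0 < T) :
    HasMalliavinDeriv hU (mollInv γ κ U φ T)
      (fun ω => -γ • ∫ θ in (0 : ℝ)..T, φ (chaos γ κ U θ ω) •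
        ∫ s in (0 : ℝ)..θ, chaosDensity γ κ U s ω • HilbertH.ind (logKernel hε hδ) s.toNNReal) ∧
    ∀ᵐ ω ∂P,
      HilbertH.IsFun
        (-γ • ∫ θ in (0 : ℝ)..T, φ (chaos γ κ U θ ω) •
          ∫ s in (0 : ℝ)..θ, chaosDensity γ κ U s ω • HilbertH.ind (logKernel hε hδ) s.toNNReal)
        (fun r => -γ * ∫ θ in (0 : ℝ)..T, φ (chaos γ κ U θ ω) *
          (chaos γ κ U (max θ r) ω - chaos γ κ U r ω)) ∧
      (∀ r : ℝ≥0,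
        -γ * ∫ θ in (0 : ℝ)..T, φ (chaos γ κ U θ ω) *
            (chaos γ κ U (max θ r) ω - chaos γ κ U r ω) =
        -γ * ∫ θ in (0 : ℝ)..T, φ (chaos γ κ U θ ω) *
            ∫ s in (0 : ℝ)..θ, (Set.Icc 0 s).indicator 1 (r : ℝ) * chaosDensity γ κ U s ω) ∧
      ∀ r : ℝ≥0, (r : ℝ) ≤ T →
        -γ * ∫ θ in (0 : ℝ)..T, φ (chaos γ κ U θ ω) *
            (chaos γ κ U (max θ r) ω - chaos γ κ U r ω) =
        -γ * ∫ y in (chaos γ κ U r ω)..(chaos γ κ U T ω),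
            φ y * (y - chaos γ κ U r ω) ∂(invMeasure γ κ U T ω) := by
  have hcφ : Continuous φ := hφ.continuous
  have hcnφ : Continuous (-φ) := hcφ.neg
  obtain ⟨C, hC⟩ := hcnφ.bounded_above_of_compact_support hφc.neg
  -- The bound on `φ(x) x` that feeds `norm_regDeriv_le`.
  obtain ⟨C', hC'⟩ := (hcnφ.mul continuous_id).bounded_above_of_compact_support
    (hφc.neg.mul_right (f' := id))
  have hΦ := smoothBounded_tailIntegral hφ hφc
  obtain ⟨A, hA⟩ := hΦ.2 0
  simp only [norm_iteratedFDeriv_zero] at hA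
  have hT' : ∀ n : ℕ, (T / (n + 1 : ℕ)) * (n + 1 : ℕ) = T := fun n =>
    div_mul_cancel₀ _ (by positivity)
  have hh : ∀ n : ℕ, 0 < T / (n + 1 : ℕ) := fun n => div_pos hT (by positivity)
  have hind : ∀ s : ℝ, ‖HilbertH.ind (logKernel hε hδ) s.toNNReal‖ ≤ √(Real.log (δ / ε)) :=
    fun s => (norm_ind_logKernel hε hδ _).le
  -- The approximations carry the sign on `Φ' = -φ`, the statement carries it on `γ`.
  have hneg : ∀ ω, -γ • ∫ θ in (0 : ℝ)..T, φ (chaos γ κ U θ ω) •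
        ∫ s in (0 : ℝ)..θ, chaosDensity γ κ U s ω • HilbertH.ind (logKernel hε hδ) s.toNNReal =
      γ • ∫ θ in (0 : ℝ)..T, (-φ) (chaos γ κ U θ ω) •
        ∫ s in (0 : ℝ)..θ, chaosDensity γ κ U s ω • HilbertH.ind (logKernel hε hδ) s.toNNReal :=
    fun ω => by simp only [Pi.neg_apply, neg_smul, intervalIntegral.integral_neg, smul_neg]
  have hlim : ∀ᵐ ω ∂P, Tendsto (fun n : ℕ => regDeriv γ κ (T / (n + 1 : ℕ)) (n + 1) (-φ)
      (fun k => U (gridPoint T n k) ω) fun k => HilbertH.ind (logKernel hε hδ) (gridPoint T n k))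
      atTop (𝓝 (-γ • ∫ θ in (0 : ℝ)..T, φ (chaos γ κ U θ ω) • ∫ s in (0 : ℝ)..θ,
        chaosDensity γ κ U s ω • HilbertH.ind (logKernel hε hδ) s.toNNReal)) := by
    filter_upwards [hcont] with ω hω
    rw [hneg]
    refine tendsto_regDeriv (γ := γ) (κ := κ) hT (continuous_path hω) (tendsto_add_atTop_nat 1)
      (fun n => Nat.succ_pos n) hcnφ hC
      (w := fun _ s => HilbertH.ind (logKernel hε hδ) s.toNNReal)
      (fun _ s => hind s) (ae_of_all _ fun s hs => ?_)
    exact ((continuous_ind_logKernel hε hδ).comp continuous_real_toNNReal).continuousAt.tendsto.comp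
      (tendsto_gridLeft hh (tendsto_div_natCast (tendsto_add_atTop_nat 1)) hs.1)
  refine ⟨?_, ?_⟩
  · refine HasMalliavinDeriv.of_tendsto hU
      (F := fun n ω => regFun γ κ (T / (n + 1 : ℕ)) (n + 1) (tailIntegral φ)
        fun k => U (gridPoint T n k) ω)
      (fun n => aestronglyMeasurable_regFun hU hΦ.1.continuous _ _)
      (fun n => aestronglyMeasurable_regDeriv hU hcnφ _ _ _)
      (A := T * A) (B := T * (|γ| * √(Real.log (δ / ε)) * C')) (fun n ω => ?_) (fun n ω => ?_)
      ?_ hlim fun n hF hD => ?_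
    · refine (abs_regFun_le (hh n).le hA _).trans_eq ?_
      rw [← mul_assoc, hT']
    · refine (norm_regDeriv_le (hh n).le hC' (Real.sqrt_nonneg _) _ fun k => hind _).trans_eq ?_
      rw [← mul_assoc, hT']
    · filter_upwards [hcont] with ω hω
      rw [mollInv_eq_integral hω hT (hcφ.integrable_of_hasCompactSupport hφc)]
      exact tendsto_regFun (γ := γ) (κ := κ) hT (continuous_path hω) (tendsto_add_atTop_nat 1)
        (fun n => Nat.succ_pos n) hΦ.1.continuous hA
    · simp only [← deriv_tailIntegral hcφ hφc] at hD ⊢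
      exact mem_cylGraph_regFun hU hΦ (gridPoint T n) hF hD
  · filter_upwards [hcont, hlim] with ω hω hlimω
    -- The witnesses are the step functions whose images in `ℋ` were shown to converge in `hlim`.
    refine ⟨⟨fun n => regDeriv γ κ (T / (n + 1 : ℕ)) (n + 1) (-φ)
      (fun k => U (gridPoint T n k) ω) fun k => StepFun.ind _ (gridPoint T n k), ?_, ?_⟩,
      fun r => ?_, fun r hr => ?_⟩
    · have h := tendstoUniformly_eval_regDeriv (γ := γ) (κ := κ) (logKernel hε hδ) hω hT hcnφ hC
      simp only [Pi.neg_apply, neg_mul, intervalIntegral.integral_neg, mul_neg] at h ⊢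
      exact h
    · refine hlimω.congr fun n => ?_
      exact (map_regDeriv (UniformSpace.Completion.toComplL (𝕜 := ℝ)
        (E := StepFun (logKernel hε hδ))).toLinearMap _ _ _ _ _ _ _).symm
    · rw [integral_chaos_max_eq hω hT]
    · rw [integral_comp_chaos_eq hω hT hcφ r.coe_nonneg hr]
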